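/- **Setting.** Let $T>0$, $d\ge 1$, and let $\hat{\mathcal T}_h$ be a finite conforming family of nondegenerate $d$-simplices in $\mathbb R^d$, with $\hat\Omega_h$ the interior of their union. For $t\in[0,T]$ let $\mathcal A_{h,t}:\overline{\hat\Omega_h}\to\mathbb R^d$ be injective and affine on every closed cell $\hat K\in\hat{\mathcal T}_h$, with $\mathcal A_{h,t}(\hat\Omega_h)=:\Omega_{h,t}$ open and $t\mapsto \mathcal A_{h,t}(Y)$ of class $C^1$ on $[0,T]$ for each $Y$. The moving cells are $K=K_t=\mathcal A_{h,t}(\hat K)$, they form $\mathcal T_{h,t}$, and $h_K=\operatorname{diam}K_t$. The mesh velocity is $\mathbf w_h(t,\cdot)=\partial_t\mathcal A_{h,t}\circ\mathcal A_{h,t}^{-1}$. Let $\hat V_h$ be a finite-dimensional space with basis $\hat\phi_1,\dots,\hat\phi_N$, consisting of functions that are continuous on $\overline{\hat\Omega_h}$, vanish on $\partial\hat\Omega_h$ and are $C^2$ on every closed cell (for instance piecewise polynomials), and let $V_h=V_h(t)=\{\hat v\circ\mathcal A_{h,t}^{-1}:\hat v\in\hat V_h\}\subset H^1_0(\Omega_{h,t})$.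 Let $\epsilon,\mu>0$ be constants. Let $\mathbf b,c,f$ be continuous on the closed space-time domain $\{(t,x):t\in[0,T],\,x\in\overline{\Omega_{h,t}}\}$, with $\mathbf b(t,\cdot)\in C^1(\overline{\Omega_{h,t}})$ for every $t$, and assume $\mu\le c-\tfrac12\nabla\cdot\mathbf b$ in $\Omega_{h,t}$ for all $t\in[0,T]$. Let the stabilization parameters $\delta_K=\delta_K(t)\ge 0$ be bounded and measurable in $t$ and satisfy, for all $t$ and $K$, $$2\,\|c\|_{K,\infty}^2\,\delta_K\le\mu,\qquad 2\,\epsilon\, c_{inv}^2\,\delta_K\le h_K^2,$$ where $c_{inv}\ge0$ is a constant in the inverse inequality $\|\Delta v_h\|_{0,K}\le c_{inv}h_K^{-1}|v_h|_{1,K}$ for all $v_h\in V_h(t)$, $K\in\mathcal T_{h,t}$, $t\in[0,T]$. Let $u_h(t,\cdot)=\sum_i u_i(t)\,\hat\phi_i\circ\mathcal A_{h,t}^{-1}$, with coefficients $u_i$ continuous on $[0,T]$ and differentiable on $(0,T]$ (one-sidedly at $T$), be a solution of the semidiscrete conservative ALE-SUPG problem: for all $t\in(0,T]$ and all $v_h=\hat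 v\circ\mathcal A_{h,t}^{-1}$ with $\hat v\in\hat V_h$ independent of $t$, $$\frac{d}{dt}(u_h,v_h)+a_{SUPG}(u_h,v_h)-\int_{\Omega_{h,t}}\nabla\cdot(\mathbf w_hu_h)\,v_h\,dx=\int_{\Omega_{h,t}}fv_h\,dx+\sum_{K\in\mathcal T_{h,t}}\delta_K\int_K f\,(\mathbf b-\mathbf w_h)\cdot\nabla v_h\,dx,$$ where $(\cdot,\cdot)$ is the $L^2(\Omega_{h,t})$ inner product and $$a_{SUPG}(u,v)=\epsilon(\nabla u,\nabla v)+(\mathbf b\cdot\nabla u,v)+(cu,v)+\sum_{K\in\mathcal T_{h,t}}\delta_K\big(-\epsilon\Delta u+(\mathbf b-\mathbf w_h)\cdot\nabla u+cu,\ (\mathbf b-\mathbf w_h)\cdot\nabla v\big)_K .$$ Put $$|||u|||^2=\epsilon|u|_1^2+\sum_{K\in\mathcal T_{h,t}}\delta_K\|(\mathbf b-\mathbf w_h)\cdot\nabla u\|_{0,K}^2+\mu\|u\|_0^2 ,$$ where $\|\cdot\|_0$ and $|\cdot|_1$ are the $L^2(\Omega_{h,t})$ norm and the $H^1(\Omega_{h,t})$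 seminorm. **Stability estimate.** The time integrals below exist and are finite, and $$\|u_h(T)\|_0^2+\frac12\int_0^T|||u_h|||^2\,dt\le\|u_h(0)\|_0^2+\frac2\mu\int_0^T\|f\|_0^2\,dt+2\int_0^T\sum_{K\in\mathcal T_{h,t}}\delta_K\|f\|_{0,K}^2\,dt .$$ The right-hand side does not involve the mesh velocity. -/

import Mathlib

open Set MeasureTheory

noncomputable section

namespace ALESUPG

/-- The Euclidean space `ℝ^d`. -/
abbrev Space (d : ℕ) : Type := EuclideanSpace ℝ (Fin d)

/-- The divergence `∑ᵢ ∂ᵢ Fᵢ` of a vector field. -/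
def divergence {d : ℕ} (F : Space d → Space d) (x : Space d) : ℝ :=
  ∑ i, (fderiv ℝ F x (EuclideanSpace.single i 1)) i

/-- The norm of `L²(S)`, for scalar or vector valued functions. -/
def l2Norm {d : ℕ} {F : Type*} [NormedAddCommGroup F] (S : Set (Space d)) (g : Space d → F) : ℝ :=
  Real.sqrt (∫ x in S, ‖g x‖ ^ 2)

/-- The `H¹(S)` seminorm `‖∇v‖_{L²(S)}`. -/
def h1Seminorm {d : ℕ} (S : Set (Space d)) (v : Space d → ℝ) : ℝ :=
  l2Norm S (gradient v)

/-- The supremum of `|g|` over `S`. -/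
def supNorm {d : ℕ} (S : Set (Space d)) (g : Space d → ℝ) : ℝ :=
  sSup ((fun x => |g x|) '' S)

/-- A finite conforming family of nondegenerate `d`-simplices in `ℝ^d`. A cell is given by its
set of vertices; the corresponding closed simplex is the convex hull of the vertices. -/
structure Triangulation (d : ℕ) where
  cells : Finset (Finset (Space d))
  card_eq : ∀ K ∈ cells, K.card = d + 1
  affineIndependent : ∀ K ∈ cells, AffineIndependent ℝ (Subtype.val : K → Space d)
  conforming : ∀ K ∈ cells, ∀ L ∈ cells,
    convexHull ℝ (K : Set (Space d)) ∩ convexHull ℝ (L : Set (Space d)) ⊆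
      convexHull ℝ ((K : Set (Space d)) ∩ (L : Set (Space d)))

namespace Triangulation

variable {d : ℕ} (𝒯 : Triangulation d)

/-- The union of the closed cells. -/
def closedRegion : Set (Space d) :=
  ⋃ K ∈ 𝒯.cells, convexHull ℝ (K : Set (Space d))

/-- The triangulated open reference domain. -/
def region : Set (Space d) := interior 𝒯.closedRegion

end Triangulation

/-- A semidiscrete ALE mapping on the time interval `[0, T]`: at each time it is a piecewise linear
(affine on each closed reference cell) injective map of the closed reference domain which carries
the open reference domain onto an open set, and every point moves in a `C¹` way. -/
structure ALEMap {d : ℕ} (𝒯 : Triangulation d) (T : ℝ) where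
  map : ℝ → Space d → Space d
  piecewiseAffine : ∀ t ∈ Icc 0 T, ∀ K ∈ 𝒯.cells, ∃ L : Space d →ᵃ[ℝ] Space d,
    EqOn (map t) L (convexHull ℝ (K : Set (Space d)))
  contDiff_time : ∀ Y ∈ 𝒯.closedRegion, ContDiffOn ℝ 1 (fun t => map t Y) (Icc 0 T)
  injOn : ∀ t ∈ Icc 0 T, InjOn (map t) 𝒯.closedRegion
  isOpen_image : ∀ t ∈ Icc 0 T, IsOpen (map t '' 𝒯.region)

namespace ALEMap

variable {d : ℕ} {𝒯 : Triangulation d} {T : ℝ} (A : ALEMap 𝒯 T)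

/-- The moving domain `Ω_{h,t}`. -/
def domain (t : ℝ) : Set (Space d) := A.map t '' 𝒯.region

/-- The closure of the moving domain, i.e. the union of the closed moving cells. -/
def closedDomain (t : ℝ) : Set (Space d) := A.map t '' 𝒯.closedRegion

/-- The moving cell at time `t` which corresponds to the reference cell `K`. -/
def cell (t : ℝ) (K : Finset (Space d)) : Set (Space d) :=
  A.map t '' convexHull ℝ (K : Set (Space d))

/-- The closed space-time domain. -/
def spaceTime : Set (ℝ × Space d) := {p | p.1 ∈ Icc 0 T ∧ p.2 ∈ A.closedDomain p.1}

/-- The Eulerian function `v̂ ∘ A_t⁻¹` of a function `v̂` on the reference domain. -/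
def push {F : Type*} (t : ℝ) (v : Space d → F) : Space d → F :=
  fun x => v (Function.invFunOn (A.map t) 𝒯.closedRegion x)

/-- The mesh velocity `w_h` in the Eulerian frame: the time derivative of the ALE mapping at a
fixed reference point (one-sided at `0` and `T`), composed with the inverse ALE mapping. -/
def velocity (t : ℝ) : Space d → Space d :=
  A.push t fun Y => derivWithin (fun s => A.map s Y) (Icc 0 T) t

end ALEMap

/-- An `H¹₀`-conforming finite element space on the reference domain, given by a basis. The basis
functions are extended by zero, are continuous (so they vanish on the boundary), and are
`C²` on each closed cell (for instance, polynomial on each cell). -/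
structure FESpace {d : ℕ} (𝒯 : Triangulation d) (N : ℕ) where
  basis : Fin N → Space d → ℝ
  linearIndependent : LinearIndependent ℝ basis
  continuous : ∀ i, Continuous (basis i)
  eq_zero : ∀ i, ∀ Y ∉ 𝒯.region, basis i Y = 0
  contDiffOn_cell : ∀ i, ∀ K ∈ 𝒯.cells,
    ContDiffOn ℝ 2 (basis i) (convexHull ℝ (K : Set (Space d)))

/-- The span of the basis functions. -/
def FESpace.space {d N : ℕ} {𝒯 : Triangulation d} (V : FESpace 𝒯 N) :
    Submodule ℝ (Space d → ℝ) :=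
  Submodule.span ℝ (range V.basis)

section Scheme

variable {d : ℕ} {𝒯 : Triangulation d} {T : ℝ} (A : ALEMap 𝒯 T)
  (ε : ℝ) (b : ℝ → Space d → Space d) (c f : ℝ → Space d → ℝ)
  (δ : ℝ → Finset (Space d) → ℝ)

/-- The streamline derivative `(b - w_h) · ∇v` at time `t`. -/
def streamline (t : ℝ) (v : Space d → ℝ) (x : Space d) : ℝ :=
  inner ℝ (b t x - A.velocity t x) (gradient v x)

/-- The bilinear form `a_SUPG(u, v)` at time `t`. -/
def aSUPG (t : ℝ) (u v : Space d → ℝ) : ℝ :=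
  ε * (∫ x in A.domain t, inner ℝ (gradient u x) (gradient v x))
    + (∫ x in A.domain t, inner ℝ (b t x) (gradient u x) * v x)
    + (∫ x in A.domain t, c t x * u x * v x)
    + ∑ K ∈ 𝒯.cells, δ t K * ∫ x in A.cell t K,
        (-ε * Laplacian.laplacian u x + streamline A b t u x + c t x * u x)
          * streamline A b t v x

/-- The square of the mesh dependent norm `|||u|||` at time `t`. -/
def tripleNormSq (μ t : ℝ) (u : Space d → ℝ) : ℝ :=
  ε * h1Seminorm (A.domain t) u ^ 2
    + (∑ K ∈ 𝒯.cells, δ t K * l2Norm (A.cell t K) (streamline A b t u) ^ 2)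
    + μ * l2Norm (A.domain t) u ^ 2

/-- `cinv` is a constant in the inverse inequality
`‖Δ v_h‖_{0,K} ≤ cinv h_K⁻¹ |v_h|_{1,K}` on the finite element spaces `V_h` at all times. -/
def IsInverseConstant {N : ℕ} (V : FESpace 𝒯 N) (cinv : ℝ) : Prop :=
  0 ≤ cinv ∧ ∀ t ∈ Icc 0 T, ∀ K ∈ 𝒯.cells, ∀ v ∈ V.space,
    l2Norm (A.cell t K) (Laplacian.laplacian (A.push t v)) ≤
      cinv * (Metric.diam (A.cell t K))⁻¹ * h1Seminorm (A.cell t K) (A.push t v)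

/-- The Eulerian finite element function `∑ᵢ uᵢ(t) φᵢ(·, t)`, with `φᵢ(·, t) = φ̂ᵢ ∘ A_t⁻¹`. -/
def feFunction {N : ℕ} (V : FESpace 𝒯 N) (U : ℝ → Fin N → ℝ) (t : ℝ) : Space d → ℝ :=
  A.push t (∑ i, U t i • V.basis i)

/-- `u_h = feFunction A V U` solves the semidiscrete conservative ALE-SUPG problem. The test
functions are transported by the ALE mapping: `v_h(·, t) = v ∘ A_t⁻¹` with `v` independent of
time. -/
structure IsSemidiscreteSolution {N : ℕ} (V : FESpace 𝒯 N) (U : ℝ → Fin N → ℝ) : Prop where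
  continuousOn : ContinuousOn U (Icc 0 T)
  differentiable : ∀ t ∈ Ioc 0 T, DifferentiableWithinAt ℝ U (Icc 0 T) t
  equation : ∀ t ∈ Ioc 0 T, ∀ v ∈ V.space, ∃ D : ℝ,
    HasDerivWithinAt
      (fun s => ∫ x in A.domain s, feFunction A V U s x * A.push s v x) D (Icc 0 T) t ∧
    D + aSUPG A ε b c δ t (feFunction A V U t) (A.push t v)
      - (∫ x in A.domain t,
          divergence (fun y => feFunction A V U t y • A.velocity t y) x * A.push t v x)
      = (∫ x in A.domain t, f t x * A.push t v x)
        + ∑ K ∈ 𝒯.cells, δ t K * ∫ x in A.cell t K, f t x * streamline A b t (A.push t v) x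

end Scheme

end ALESUPG

end

/-! The proof is an energy argument: the scheme at time `t` is tested with `u_h(t)`, its
coefficients frozen at `t` and transported by the mesh. Two mesh-velocity terms then appear and
cancel exactly. Reynolds' theorem (`hasDerivWithinAt_l2Norm_feFunction_sq`) gives d/dt ‖u_h‖² = 2D −
∫ (div w) u_h², where D is the derivative of the mass term against the frozen test function.
Integration by parts (`integral_divergence_smul_velocity`) gives ∫ div(w u_h) u_h = ½ ∫ (div w)
u_h². Hence d/dt ‖u_h‖² = 2(load − a_SUPG(u_h, u_h)), and no estimate of the mesh velocity is
needed.

At fixed time, `load_sub_aSUPG_le` bounds load − a_SUPG by ‖f‖²/μ + Σ δ_K ‖f‖_K² − ¼|||u_h|||².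
Convection and reaction together give at least μ‖u_h‖². The two conditions on δ_K let the Laplacian
and reaction parts of the stabilization be absorbed in half of the diffusion and half of the μ term.
Young's inequality handles the load. Integration over [0, T] finishes the proof.

Two analytic facts carry this. The divergence theorem is obtained without traces: a field that is
Lipschitz on each cell and zero on the boundary extends by zero to a compactly supported Lipschitz
field, whose divergence has zero integral. Reynolds' theorem reduces to Jacobi's formula: the map is
affine on a cell, so the mass integrals are a Jacobian depending only on time multiplied by a
bilinear form in the coefficients. -/

noncomputable section

namespace ALESUPG

/-! ### Lipschitz vector fields and the derivative of the determinant. -/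

section

/-- A function that is `C`-Lipschitz on each member of a finite closed cover of a real normed space
is `C`-Lipschitz. -/
theorem lipschitzWith_of_finite_closed_cover {E F ι : Type*} [NormedAddCommGroup E]
    [NormedSpace ℝ E] [NormedAddCommGroup F] [Finite ι] {S : ι → Set E}
    (hS : ∀ i, IsClosed (S i)) (hcov : ⋃ i, S i = univ) {C : NNReal} {f : E → F}
    (hf : ∀ i, LipschitzOnWith C f (S i)) : LipschitzWith C f := by
  have hcont : Continuous f :=
    (locallyFinite_of_finite S).continuous hcov hS fun i => (hf i).continuousOn
  refine LipschitzWith.of_dist_le_mul fun x y => ?_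
  rw [dist_comm (f x), dist_comm x, dist_eq_norm, dist_eq_norm]
  set γ : ℝ → E := fun s => x + s • (y - x) with hγ
  have hγc : Continuous γ := by fun_prop
  -- The mean value inequality along the segment needs a strict bound on the slope, so it is proved
  -- for every larger constant `M`, which is then lowered.
  have key : ∀ M : ℝ, C * ‖y - x‖ < M → ‖f y - f x‖ ≤ M := by
    intro M hM
    have h := image_norm_le_of_liminf_right_slope_norm_lt_deriv_boundary
      (f := fun s => f (γ s) - f x) (f' := fun _ => C * ‖y - x‖) (a := 0) (b := 1)
      (B := fun s => M * s) (B' := fun _ => M)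
      (by fun_prop) ?_ (by simp [hγ]) (by fun_prop)
      (fun s _ => by simpa using ((hasDerivAt_id s).const_mul M).hasDerivWithinAt)
      (fun _ _ _ => hM) (right_mem_Icc.2 zero_le_one)
    · simpa [hγ] using h
    · intro s _ r hr
      -- Since the pieces are closed and finitely many, points near `γ s` lie only in pieces that
      -- also contain `γ s`. Any piece containing `γ z` therefore bounds the slope, and the segment
      -- need not be subdivided.
      have hev : ∀ᶠ z in nhds s, ∀ i, γ z ∈ S i → γ s ∈ S i := by
        rw [Filter.eventually_all]
        intro i
        by_cases hi : γ s ∈ S i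
        · exact Filter.Eventually.of_forall fun _ _ => hi
        · filter_upwards [hγc.continuousAt.preimage_mem_nhds ((hS i).isOpen_compl.mem_nhds hi)]
            with z hz hz' using absurd hz' hz
      refine Filter.Eventually.frequently ?_
      filter_upwards [nhdsWithin_le_nhds hev, self_mem_nhdsWithin] with z hz hsz
      have hsz' : 0 < z - s := sub_pos.2 hsz
      obtain ⟨i, hi⟩ := mem_iUnion.1 (hcov ▸ mem_univ (γ z) : γ z ∈ ⋃ i, S i)
      have h1 := (hf i).dist_le_mul _ hi _ (hz i hi)
      have h2 : γ z - γ s = (z - s) • (y - x) := by simp only [hγ]; module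
      rw [dist_eq_norm, dist_eq_norm, h2, norm_smul, Real.norm_of_nonneg hsz'.le] at h1
      refine lt_of_le_of_lt ?_ hr
      rw [slope_def_field, div_le_iff₀ hsz']
      have h3 := norm_sub_norm_le (f (γ z) - f x) (f (γ s) - f x)
      rw [sub_sub_sub_cancel_right] at h3
      simp only [Function.comp]
      linarith
  exact le_of_forall_gt_imp_ge_of_dense key

/-- The divergence of a compactly supported Lipschitz vector field has integral zero. -/
theorem integral_divergence_eq_zero {d : ℕ} {C : NNReal} {F : Space d → Space d}
    (hF : LipschitzWith C F) (hs : HasCompactSupport F) : ∫ x, divergence F x = 0 := by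
  have hi : ∀ i, LipschitzWith C (fun x => F x i) := fun i => by
    simpa using (LipschitzWith.of_dist_le_mul (fun x y => by
      rw [dist_eq_norm, dist_eq_norm]
      refine le_trans ?_ (hF.norm_sub_le x y)
      simpa using PiLp.norm_apply_le (F x - F y) i) : LipschitzWith C (fun x => F x i))
  have hsi : ∀ i, HasCompactSupport (fun x => F x i) := fun i =>
    hs.comp_left (g := fun y : Space d => y i) rfl
  have hd : ∀ᵐ x, divergence F x
      = ∑ i, lineDeriv ℝ (fun y => F y i) x (EuclideanSpace.single i 1) := by
    filter_upwards [hF.ae_differentiableAt] with x hx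
    refine Finset.sum_congr rfl fun i _ => ?_
    have h1 : HasFDerivAt (fun y => F y i)
        ((EuclideanSpace.proj i : Space d →L[ℝ] ℝ).comp (fderiv ℝ F x)) x :=
      (EuclideanSpace.proj i : Space d →L[ℝ] ℝ).hasFDerivAt.comp x hx.hasFDerivAt
    rw [h1.differentiableAt.lineDeriv_eq_fderiv, h1.fderiv]
    rfl
  rw [integral_congr_ae hd, integral_finsetSum]
  · refine Finset.sum_eq_zero fun i _ => ?_
    -- Integration by parts against the constant 1. The minus sign makes the derivative that lands
    -- on the component of `F` point along `+e_i`.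
    have h := LipschitzWith.integral_lineDeriv_mul_eq (μ := volume) (LipschitzWith.const (1 : ℝ))
      (hi i) (hsi i) (-EuclideanSpace.single i 1)
    have h0 : ∀ x : Space d,
        lineDeriv ℝ (fun _ : Space d => (1 : ℝ)) x (-EuclideanSpace.single i 1) = 0 :=
      fun x => by simp [lineDeriv]
    simpa [h0] using h.symm
  · intro i _
    -- The line derivative is bounded and lives on a compact set, hence is integrable.
    have hsub : Function.support
        (fun x => lineDeriv ℝ (fun y => F y i) x (EuclideanSpace.single i 1))
          ⊆ tsupport (fun y => F y i) := by
      intro x hx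
      by_contra hx'
      refine hx ?_
      have h0 : (fun y => F y i) =ᶠ[nhds x] fun _ => 0 := notMem_tsupport_iff_eventuallyEq.1 hx'
      beta_reduce
      rw [h0.lineDeriv_eq]
      simp [lineDeriv]
    rw [← integrableOn_iff_integrable_of_support_subset hsub]
    have hm := (hi i).memLp_lineDeriv (μ := volume) (EuclideanSpace.single i (1 : ℝ))
    have : IsFiniteMeasure (volume.restrict (tsupport fun y => F y i)) :=
      ⟨by simpa using (hsi i).isCompact.measure_lt_top⟩
    exact (hm.restrict _).integrable le_top

/-- The Leibniz formula is a polynomial in the matrix entries, and each entry is a continuous linear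
functional of the operator. -/
theorem contDiff_continuousLinearMap_det {d : ℕ} :
    ContDiff ℝ 1 (fun M : Space d →L[ℝ] Space d => M.det) := by
  have h : (fun M : Space d →L[ℝ] Space d => M.det) = fun M => ∑ σ : Equiv.Perm (Fin d),
      ((Equiv.Perm.sign σ : ℤ) : ℝ) * ∏ i, (M (EuclideanSpace.single i 1)) (σ i) := by
    ext M
    rw [ContinuousLinearMap.det,
      ← LinearMap.det_toMatrix (EuclideanSpace.basisFun (Fin d) ℝ).toBasis, Matrix.det_apply]
    refine Finset.sum_congr rfl fun σ _ => ?_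
    simp [LinearMap.toMatrix_apply, Units.smul_def]
  rw [h]
  refine ContDiff.sum fun σ _ => contDiff_const.mul (contDiff_prod fun i _ => ?_)
  exact ((EuclideanSpace.proj (σ i) : Space d →L[ℝ] ℝ).comp
    (ContinuousLinearMap.apply ℝ (Space d) (EuclideanSpace.single i (1 : ℝ)))).contDiff

/-- The linear coefficient is the trace. The polynomial remainder makes the derivative at `s = 0`
immediate. -/
theorem det_one_add_smul_expansion {d : ℕ} (N : Space d →L[ℝ] Space d) :
    ∃ p : Polynomial ℝ, ∀ s : ℝ, (1 + s • N).det
      = 1 + (∑ i, (N (EuclideanSpace.single i 1)) i) * s + p.eval s * s ^ 2 := by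
  set e := (EuclideanSpace.basisFun (Fin d) ℝ).toBasis with he
  set M := LinearMap.toMatrix e e (N : Space d →ₗ[ℝ] Space d) with hM
  refine ⟨(1 + (Polynomial.X : Polynomial ℝ) • M.map Polynomial.C).det.divX.divX, fun s => ?_⟩
  have h1 : (1 + s • N).det = (1 + s • M).det := by
    rw [ContinuousLinearMap.det, ← LinearMap.det_toMatrix e]
    congr 1
    simp [hM, Module.End.one_eq_id]
  rw [h1, Matrix.det_one_add_smul]
  simp [hM, Matrix.trace, LinearMap.toMatrix_apply, he]

/-- Jacobi's formula for the absolute value of the determinant. -/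
theorem hasDerivWithinAt_abs_det {d : ℕ} {B : ℝ → Space d →L[ℝ] Space d}
    {B' Binv : Space d →L[ℝ] Space d} {s : Set ℝ} {t : ℝ} (hB : HasDerivWithinAt B B' s t)
    (hinv : ∀ x, B t (Binv x) = x) (hdet : (B t).det ≠ 0) :
    HasDerivWithinAt (fun r => |(B r).det|)
      (|(B t).det| * ∑ i, (B' (Binv (EuclideanSpace.single i 1))) i) s t := by
  have hD := contDiff_continuousLinearMap_det (d := d).differentiable one_ne_zero (B t)
  have hfd : fderiv ℝ (fun M : Space d →L[ℝ] Space d => M.det) (B t) B'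
      = (B t).det * ∑ i, (B' (Binv (EuclideanSpace.single i 1))) i := by
    -- The factorization B + rB' = (1 + r B' B⁻¹) B moves the computation from `B t` to the
    -- identity.
    obtain ⟨p, hp⟩ := det_one_add_smul_expansion (B'.comp Binv)
    have h1 : HasDerivAt (fun r : ℝ => (B t + r • B').det)
        (fderiv ℝ (fun M : Space d →L[ℝ] Space d => M.det) (B t) B') 0 := by
      have h2 : HasDerivAt (fun r : ℝ => B t + r • B') B' 0 := by
        simpa using ((hasDerivAt_id (0 : ℝ)).smul_const B').const_add (B t)
      exact hD.hasFDerivAt.comp_hasDerivAt_of_eq 0 h2 (by ext; simp)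
    have h4 : (fun r : ℝ => (B t + r • B').det) = fun r => (B t).det *
        (1 + (∑ i, (B' (Binv (EuclideanSpace.single i 1))) i) * r + p.eval r * r ^ 2) := by
      ext r
      have h5 := hp r
      simp only [ContinuousLinearMap.comp_apply] at h5
      have hli : ∀ x, Binv (B t x) = x := by
        intro x
        have hinj : Function.Injective (B t) := by
          have := ((B t).toContinuousLinearEquivOfDetNeZero hdet).injective
          intro y z hyz
          exact this (by simpa using hyz)
        exact hinj (hinv _)
      rw [← h5, ContinuousLinearMap.det, ContinuousLinearMap.det, ContinuousLinearMap.det, mul_comm,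
        ← LinearMap.det_comp]
      congr 1
      ext x
      simp [hli]
    have h6 : HasDerivAt (fun r : ℝ => (B t).det *
        (1 + (∑ i, (B' (Binv (EuclideanSpace.single i 1))) i) * r + p.eval r * r ^ 2))
        ((B t).det * ∑ i, (B' (Binv (EuclideanSpace.single i 1))) i) 0 := by
      have h7 := ((((hasDerivAt_id (0 : ℝ)).const_mul
        (∑ i, (B' (Binv (EuclideanSpace.single i 1))) i)).const_add 1).add
        ((p.hasDerivAt 0).mul ((hasDerivAt_id (0 : ℝ)).pow 2))).const_mul (B t).det
      exact h7.congr_deriv (by simp)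
    rw [h4] at h1
    exact h1.unique h6
  have hdd : HasDerivWithinAt (fun r => (B r).det)
      ((B t).det * ∑ i, (B' (Binv (EuclideanSpace.single i 1))) i) s t := by
    rw [← hfd]
    exact hD.hasFDerivAt.comp_hasDerivWithinAt t hB
  rcases hdet.lt_or_gt with h | h
  · refine ((hasDerivAt_abs_neg h).comp_hasDerivWithinAt t hdd).congr_deriv ?_
    rw [abs_of_neg h]; ring
  · refine ((hasDerivAt_abs_pos h).comp_hasDerivWithinAt t hdd).congr_deriv ?_
    rw [abs_of_pos h]; ring

end

/-! ### Geometry of the reference and moving cells, and change of variables. -/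

section

namespace Triangulation

variable {d : ℕ} {𝒯 : Triangulation d} {K L : Finset (Space d)}

theorem affineSpan_cell (hK : K ∈ 𝒯.cells) : affineSpan ℝ (K : Set (Space d)) = ⊤ := by
  have h := (𝒯.affineIndependent K hK).affineSpan_eq_top_iff_card_eq_finrank_add_one
  simpa [𝒯.card_eq K hK] using h

/-- The vertices of a cell as an affine basis of the space. -/
def affineBasis (hK : K ∈ 𝒯.cells) : AffineBasis K ℝ (Space d) :=
  ⟨Subtype.val, 𝒯.affineIndependent K hK, by simpa using affineSpan_cell hK⟩

theorem interior_cell_nonempty (hK : K ∈ 𝒯.cells) :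
    (interior (convexHull ℝ (K : Set (Space d)))).Nonempty :=
  interior_convexHull_nonempty_iff_affineSpan_eq_top.2 (affineSpan_cell hK)

theorem isCompact_convexHull (K : Finset (Space d)) :
    IsCompact (convexHull ℝ (K : Set (Space d))) :=
  K.finite_toSet.isCompact_convexHull ℝ

theorem cell_subset_closedRegion (hK : K ∈ 𝒯.cells) :
    convexHull ℝ (K : Set (Space d)) ⊆ 𝒯.closedRegion :=
  subset_biUnion_of_mem (u := fun K : Finset (Space d) => convexHull ℝ (K : Set (Space d))) hK

/-- By conformity the overlap lies in the affine span of the common vertices. Distinct cells share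
fewer than d + 1 vertices, so this span is a proper subspace, hence null. -/
theorem volume_inter_cell (hK : K ∈ 𝒯.cells) (hL : L ∈ 𝒯.cells) (hKL : K ≠ L) :
    volume (convexHull ℝ (K : Set (Space d)) ∩ convexHull ℝ (L : Set (Space d))) = 0 := by
  classical
  have hne : affineSpan ℝ ((K ∩ L : Finset (Space d)) : Set (Space d)) ≠ ⊤ := by
    intro htop
    have hind : AffineIndependent ℝ (Subtype.val : ↥(K ∩ L) → Space d) :=
      (𝒯.affineIndependent K hK).mono (s := (↑(K ∩ L) : Set (Space d))) (by simp)
    have h := hind.affineSpan_eq_top_iff_card_eq_finrank_add_one.1 (by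
      rw [Subtype.range_val_subtype]
      exact htop)
    rw [Fintype.card_coe, finrank_euclideanSpace_fin] at h
    have h1 := Finset.eq_of_subset_of_card_le (Finset.inter_subset_left : K ∩ L ⊆ K)
      (by rw [h, 𝒯.card_eq K hK])
    have h2 := Finset.eq_of_subset_of_card_le (Finset.inter_subset_right : K ∩ L ⊆ L)
      (by rw [h, 𝒯.card_eq L hL])
    exact hKL (h1.symm.trans h2)
  refine measure_mono_null ?_ (Measure.addHaar_affineSubspace volume _ hne)
  refine (𝒯.conforming K hK L hL).trans ?_
  rw [Finset.coe_inter]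
  exact convexHull_subset_affineSpan _

end Triangulation

variable {d : ℕ} {𝒯 : Triangulation d} {T : ℝ}

/-- The affine representation of an ALE map on a reference cell, with its time derivative. -/
structure CellMotion (A : ALEMap 𝒯 T) (K : Finset (Space d)) where
  lin : ℝ → Space d →L[ℝ] Space d
  trans : ℝ → Space d
  lin' : ℝ → Space d →L[ℝ] Space d
  trans' : ℝ → Space d
  map_eq : ∀ t ∈ Icc 0 T, ∀ Y ∈ convexHull ℝ (K : Set (Space d)), A.map t Y = lin t Y + trans t
  hasDeriv_lin : ∀ t ∈ Icc 0 T, HasDerivWithinAt lin (lin' t) (Icc 0 T) t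
  hasDeriv_trans : ∀ t ∈ Icc 0 T, HasDerivWithinAt trans (trans' t) (Icc 0 T) t
  continuousOn_lin' : ContinuousOn lin' (Icc 0 T)
  continuousOn_trans' : ContinuousOn trans' (Icc 0 T)
  det_ne_zero : ∀ t ∈ Icc 0 T, (lin t).det ≠ 0

/-- Interpolating the vertex trajectories in barycentric coordinates reproduces the map on the cell,
so regularity in time comes from finitely many points. Injectivity makes the linear part invertible.
-/
theorem exists_cellMotion (hT : 0 < T) (A : ALEMap 𝒯 T) {K : Finset (Space d)}
    (hK : K ∈ 𝒯.cells) : Nonempty (CellMotion A K) := by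
  set β := Triangulation.affineBasis hK
  have hβ : ∀ v : K, β v = v := fun v => rfl
  let c : K → Space d →L[ℝ] ℝ := fun v => (β.coord v).linear.toContinuousLinearMap
  let x : K → ℝ → Space d := fun v t => A.map t v
  have hmem : ∀ v : K, (v : Space d) ∈ convexHull ℝ (K : Set (Space d)) := fun v =>
    subset_convexHull ℝ _ v.2
  have hx : ∀ v, ContDiffOn ℝ 1 (x v) (Icc 0 T) := fun v =>
    A.contDiff_time v (Triangulation.cell_subset_closedRegion hK (hmem v))
  have hx' : ∀ v, ∀ t ∈ Icc 0 T,
      HasDerivWithinAt (x v) (derivWithin (x v) (Icc 0 T) t) (Icc 0 T) t := fun v t ht =>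
    ((hx v).differentiableOn one_ne_zero t ht).hasDerivWithinAt
  have hxc : ∀ v, ContinuousOn (derivWithin (x v) (Icc 0 T)) (Icc 0 T) := fun v =>
    (hx v).continuousOn_derivWithin (uniqueDiffOn_Icc hT) le_rfl
  have hc : ∀ v Y, β.coord v Y = c v Y + β.coord v 0 := by
    intro v Y
    have h := (β.coord v).map_vadd 0 Y
    rw [vadd_eq_add, vadd_eq_add, add_zero] at h
    exact h
  let B : ℝ → Space d →L[ℝ] Space d := fun t => ∑ v, (c v).smulRight (x v t)
  let a : ℝ → Space d := fun t => ∑ v, β.coord v 0 • x v t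
  have hBa : ∀ t Y, B t Y + a t = ∑ v, β.coord v Y • x v t := by
    intro t Y
    simp only [B, a, sum_apply, ContinuousLinearMap.smulRight_apply,
      ← Finset.sum_add_distrib, ← add_smul, ← hc]
  have hmap : ∀ t ∈ Icc 0 T, ∀ Y ∈ convexHull ℝ (K : Set (Space d)),
      A.map t Y = B t Y + a t := by
    intro t ht Y hY
    obtain ⟨L, hL⟩ := A.piecewiseAffine t ht K hK
    let M : Space d →ᵃ[ℝ] Space d :=
      (B t : Space d →ₗ[ℝ] Space d).toAffineMap + AffineMap.const ℝ _ (a t)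
    have hLM : L = M := by
      refine AffineMap.ext_on (Triangulation.affineSpan_cell hK) fun y hy => ?_
      rw [← hL (subset_convexHull ℝ _ hy)]
      change A.map t y = B t y + a t
      rw [hBa, Finset.sum_eq_single ⟨y, hy⟩]
      · have : β.coord ⟨y, hy⟩ (β ⟨y, hy⟩) = 1 := β.coord_apply_eq _
        rw [hβ] at this
        simp [this, x]
      · intro v _ hv
        have : β.coord v (β ⟨y, hy⟩) = 0 := β.coord_apply_ne hv
        rw [hβ] at this
        simp [this]
      · simp
    rw [hL hY, hLM]
    rfl
  refine ⟨⟨B, a, fun t => ∑ v, (c v).smulRight (derivWithin (x v) (Icc 0 T) t),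
    fun t => ∑ v, β.coord v 0 • derivWithin (x v) (Icc 0 T) t, hmap, ?_, ?_, ?_, ?_, ?_⟩⟩
  · intro t ht
    refine HasDerivWithinAt.fun_sum fun v _ => ?_
    exact (ContinuousLinearMap.smulRightL ℝ (Space d) (Space d) (c v)).hasFDerivAt
      |>.comp_hasDerivWithinAt t (hx' v t ht)
  · intro t ht
    exact HasDerivWithinAt.fun_sum fun v _ => (hx' v t ht).fun_const_smul _
  · refine continuousOn_finsetSum _ fun v _ => ?_
    exact (ContinuousLinearMap.smulRightL ℝ (Space d) (Space d) (c v)).continuous.comp_continuousOn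
      (hxc v)
  · exact continuousOn_finsetSum _ fun v _ => (hxc v).fun_const_smul _
  -- A kernel vector `z` would give `Y` and `Y + s • z` the same image for small `s ≠ 0`, with both
  -- points in the cell when `Y` is interior.
  · intro t ht h0
    obtain ⟨Y, hY⟩ := Triangulation.interior_cell_nonempty hK
    obtain ⟨z, hz, hz0⟩ := SetLike.exists_of_lt (LinearMap.bot_lt_ker_of_det_eq_zero h0)
    have hz' : B t z = 0 := by simpa using hz
    have hz1 : z ≠ 0 := by simpa using hz0
    have hcont : Filter.Tendsto (fun s : ℝ => Y + s • z) (nhdsWithin 0 {0}ᶜ) (nhds Y) := by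
      have : Continuous fun s : ℝ => Y + s • z := by fun_prop
      simpa using (this.tendsto 0).mono_left nhdsWithin_le_nhds
    obtain ⟨s, hs, hs0⟩ := ((hcont.eventually (mem_interior_iff_mem_nhds.1 hY)).and
      self_mem_nhdsWithin).exists
    have h1 := A.injOn t ht (Triangulation.cell_subset_closedRegion hK hs)
      (Triangulation.cell_subset_closedRegion hK (interior_subset hY))
      (by rw [hmap t ht _ hs, hmap t ht _ (interior_subset hY)]; simp [hz'])
    have h2 : s • z = 0 := by simpa using h1
    exact (smul_eq_zero.1 h2).elim hs0 hz1

namespace CellMotion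

variable {A : ALEMap 𝒯 T} {K : Finset (Space d)} (m : CellMotion A K) {t : ℝ}

/-- The inverse of the linear part. -/
def inv (t : ℝ) : Space d →L[ℝ] Space d := (m.lin t).inverse

theorem inv_eq_symm (ht : t ∈ Icc 0 T) :
    m.inv t = ((m.lin t).toContinuousLinearEquivOfDetNeZero (m.det_ne_zero t ht)).symm := by
  have h : m.lin t = ((m.lin t).toContinuousLinearEquivOfDetNeZero (m.det_ne_zero t ht) :
      Space d →L[ℝ] Space d) := by ext; simp
  rw [inv]
  conv_lhs => rw [h]
  exact ContinuousLinearMap.inverse_equiv _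

theorem lin_inv (ht : t ∈ Icc 0 T) (x : Space d) : m.lin t (m.inv t x) = x := by
  rw [m.inv_eq_symm ht]
  exact ((m.lin t).toContinuousLinearEquivOfDetNeZero (m.det_ne_zero t ht)).apply_symm_apply x

theorem inv_lin (ht : t ∈ Icc 0 T) (x : Space d) : m.inv t (m.lin t x) = x := by
  rw [m.inv_eq_symm ht]
  exact ((m.lin t).toContinuousLinearEquivOfDetNeZero (m.det_ne_zero t ht)).symm_apply_apply x

theorem continuousOn_lin : ContinuousOn m.lin (Icc 0 T) := fun t ht =>
  (m.hasDeriv_lin t ht).continuousWithinAt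

theorem continuousOn_trans : ContinuousOn m.trans (Icc 0 T) := fun t ht =>
  (m.hasDeriv_trans t ht).continuousWithinAt

theorem continuousOn_inv : ContinuousOn m.inv (Icc 0 T) := by
  intro t ht
  have h := contDiffAt_map_inverse (𝕜 := ℝ) (n := 0)
    ((m.lin t).toContinuousLinearEquivOfDetNeZero (m.det_ne_zero t ht))
  have h' : ContinuousAt ContinuousLinearMap.inverse (m.lin t) := by
    simpa using h.continuousAt
  exact h'.comp_continuousWithinAt (m.continuousOn_lin t ht)

theorem continuousOn_abs_det : ContinuousOn (fun t => |(m.lin t).det|) (Icc 0 T) :=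
  (contDiff_continuousLinearMap_det.continuous.comp_continuousOn m.continuousOn_lin).abs

/-- The affine extension of the ALE map from a cell to the whole space. -/
def homeo (ht : t ∈ Icc 0 T) : Space d ≃ₜ Space d :=
  ((m.lin t).toContinuousLinearEquivOfDetNeZero (m.det_ne_zero t ht)).toHomeomorph.trans
    (Homeomorph.addRight (m.trans t))

theorem homeo_apply (ht : t ∈ Icc 0 T) (Y : Space d) :
    m.homeo ht Y = m.lin t Y + m.trans t := by
  simp [homeo]

theorem cell_eq (ht : t ∈ Icc 0 T) :
    A.cell t K = m.homeo ht '' convexHull ℝ (K : Set (Space d)) :=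
  image_congr fun Y hY => by rw [m.map_eq t ht Y hY, homeo_apply]

include m in
theorem isCompact_cell (ht : t ∈ Icc 0 T) : IsCompact (A.cell t K) := by
  rw [m.cell_eq ht]
  exact (Triangulation.isCompact_convexHull K).image (m.homeo ht).continuous

include m in
theorem convex_cell (ht : t ∈ Icc 0 T) : Convex ℝ (A.cell t K) := by
  have h : A.cell t K = (fun z => z + m.trans t) ''
      ((m.lin t : Space d →ₗ[ℝ] Space d) '' convexHull ℝ (K : Set (Space d))) := by
    rw [image_image]
    exact image_congr fun Y hY => m.map_eq t ht Y hY
  rw [h]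
  simp only [add_comm _ (m.trans t)]
  exact ((convex_convexHull ℝ (K : Set (Space d))).linear_image _).translate (m.trans t)

theorem interior_cell (ht : t ∈ Icc 0 T) :
    interior (A.cell t K) = m.homeo ht '' interior (convexHull ℝ (K : Set (Space d))) := by
  rw [m.cell_eq ht, Homeomorph.image_interior]

include m in
theorem interior_cell_nonempty (ht : t ∈ Icc 0 T) (hK : K ∈ 𝒯.cells) :
    (interior (A.cell t K)).Nonempty := by
  rw [m.interior_cell ht]
  exact (Triangulation.interior_cell_nonempty hK).image _

include m in
theorem interior_cell_subset_domain (ht : t ∈ Icc 0 T) (hK : K ∈ 𝒯.cells) :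
    interior (A.cell t K) ⊆ A.domain t := by
  rw [m.interior_cell ht]
  rintro _ ⟨Y, hY, rfl⟩
  refine ⟨Y, interior_mono (Triangulation.cell_subset_closedRegion hK) hY, ?_⟩
  rw [m.map_eq t ht Y (interior_subset hY), homeo_apply]

/-- Change of variables from a moving cell to its reference cell. -/
theorem integral_cell (ht : t ∈ Icc 0 T) {F : Type*} [NormedAddCommGroup F] [NormedSpace ℝ F]
    (g : Space d → F) :
    ∫ x in A.cell t K, g x =
      ∫ Y in convexHull ℝ (K : Set (Space d)), |(m.lin t).det| • g (m.lin t Y + m.trans t) := by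
  have h := integral_image_eq_integral_abs_det_fderiv_smul volume
    (Triangulation.isCompact_convexHull K).measurableSet (f := fun Y => m.lin t Y + m.trans t)
    (f' := fun _ => m.lin t)
    (fun Y _ => ((m.lin t).hasFDerivAt.add_const (m.trans t)).hasFDerivWithinAt)
    (fun Y _ Z _ hYZ => (m.homeo ht).injective (by rw [homeo_apply, homeo_apply]; exact hYZ)) g
  rw [← h, m.cell_eq ht]
  simp only [← m.homeo_apply ht]

end CellMotion

namespace ALEMap

variable (A : ALEMap 𝒯 T) {t : ℝ}

theorem cell_subset_closedDomain {K : Finset (Space d)} (hK : K ∈ 𝒯.cells) :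
    A.cell t K ⊆ A.closedDomain t :=
  image_mono (Triangulation.cell_subset_closedRegion hK)

theorem domain_subset_closedDomain : A.domain t ⊆ A.closedDomain t :=
  image_mono interior_subset

theorem closedDomain_eq_iUnion : A.closedDomain t = ⋃ K : 𝒯.cells, A.cell t K := by
  simp only [closedDomain, Triangulation.closedRegion, cell, image_iUnion, iUnion_subtype]

theorem isCompact_closedDomain (hT : 0 < T) (ht : t ∈ Icc 0 T) : IsCompact (A.closedDomain t) := by
  rw [closedDomain_eq_iUnion]
  exact isCompact_iUnion fun K => (exists_cellMotion hT A K.2).some.isCompact_cell ht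

/-- Injectivity confines the overlap of two moving cells to an affine image of the null overlap of
the reference cells. -/
theorem aedisjoint_cell (hT : 0 < T) (ht : t ∈ Icc 0 T) :
    Pairwise (Function.onFun (AEDisjoint volume) fun K : 𝒯.cells => A.cell t K) := by
  intro K L hKL
  have m := (exists_cellMotion hT A K.2).some
  have h0 := addHaar_image_eq_zero_of_differentiableOn_of_addHaar_eq_zero volume
    (f := fun Y => m.lin t Y + m.trans t)
    ((m.lin t).differentiable.add_const (m.trans t)).differentiableOn
    (Triangulation.volume_inter_cell K.2 L.2 (fun h => hKL (Subtype.ext h)))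
  refine measure_mono_null ?_ h0
  rintro x ⟨⟨Y, hY, rfl⟩, Z, hZ, hYZ⟩
  have : Z = Y := A.injOn t ht (Triangulation.cell_subset_closedRegion L.2 hZ)
    (Triangulation.cell_subset_closedRegion K.2 hY) hYZ
  exact ⟨Y, ⟨hY, this ▸ hZ⟩, (m.map_eq t ht Y hY).symm⟩

/-- Frontiers of convex sets are null. Integrands therefore need to be compared only in cell
interiors, where derivatives are classical. -/
theorem ae_mem_interior_cell (hT : 0 < T) (ht : t ∈ Icc 0 T) :
    ∀ᵐ x, x ∈ A.closedDomain t → ∃ K ∈ 𝒯.cells, x ∈ interior (A.cell t K) := by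
  have h : ∀ K : 𝒯.cells, ∀ᵐ x, x ∉ frontier (A.cell t K) := fun K =>
    measure_eq_zero_iff_ae_notMem.1
      (((exists_cellMotion hT A K.2).some.convex_cell ht).addHaar_frontier volume)
  filter_upwards [ae_all_iff.2 h] with x hx hxd
  rw [closedDomain_eq_iUnion] at hxd
  obtain ⟨K, hK⟩ := mem_iUnion.1 hxd
  refine ⟨K, K.2, ?_⟩
  by_contra hn
  exact hx K ⟨subset_closure hK, hn⟩

theorem domain_ae_eq (hT : 0 < T) (ht : t ∈ Icc 0 T) :
    A.domain t =ᵐ[volume] A.closedDomain t := by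
  filter_upwards [A.ae_mem_interior_cell hT ht] with x hx
  refine propext ⟨fun h => A.domain_subset_closedDomain h, fun h => ?_⟩
  obtain ⟨K, hK, hxK⟩ := hx h
  exact (exists_cellMotion hT A hK).some.interior_cell_subset_domain ht hK hxK

theorem integrableOn_domain (hT : 0 < T) (ht : t ∈ Icc 0 T) {F : Type*} [NormedAddCommGroup F]
    {g : Space d → F} (hg : ∀ K ∈ 𝒯.cells, IntegrableOn g (A.cell t K)) :
    IntegrableOn g (A.domain t) := by
  rw [integrableOn_congr_set_ae (A.domain_ae_eq hT ht), closedDomain_eq_iUnion]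
  exact integrableOn_finite_iUnion.2 fun K => hg K K.2

theorem integral_domain (hT : 0 < T) (ht : t ∈ Icc 0 T) {g : Space d → ℝ}
    (hg : ∀ K ∈ 𝒯.cells, IntegrableOn g (A.cell t K)) :
    ∫ x in A.domain t, g x = ∑ K ∈ 𝒯.cells, ∫ x in A.cell t K, g x := by
  have hi := (integrableOn_congr_set_ae (A.domain_ae_eq hT ht)).1 (A.integrableOn_domain hT ht hg)
  rw [setIntegral_congr_set (A.domain_ae_eq hT ht)]
  rw [closedDomain_eq_iUnion] at hi ⊢
  rw [integral_iUnion_ae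
    (fun K => ((exists_cellMotion hT A K.2).some.isCompact_cell ht).measurableSet.nullMeasurableSet)
    (A.aedisjoint_cell hT ht) hi, tsum_fintype, Finset.sum_coe_sort 𝒯.cells
      (fun K => ∫ x in A.cell t K, g x)]

theorem push_map {F : Type*} (ht : t ∈ Icc 0 T) (v : Space d → F) {Y : Space d}
    (hY : Y ∈ 𝒯.closedRegion) : A.push t v (A.map t Y) = v Y := by
  have h : ∃ Z ∈ 𝒯.closedRegion, A.map t Z = A.map t Y := ⟨Y, hY, rfl⟩
  rw [push, A.injOn t ht (Function.invFunOn_mem h) hY (Function.invFunOn_eq h)]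

end ALEMap

end

/-! ### Functions smooth up to the cell boundary, and integration by parts on the moving domain. -/

section

variable {d : ℕ} {F G H : Type*} [NormedAddCommGroup F] [NormedAddCommGroup G]
  [NormedAddCommGroup H]

/-- On the interior of `S`, the function `g` agrees with a function which is continuous on `S`. -/
def InteriorContinuous (S : Set (Space d)) (g : Space d → F) : Prop :=
  ∃ h : Space d → F, ContinuousOn h S ∧ EqOn g h (interior S)

namespace InteriorContinuous

variable {S : Set (Space d)}

theorem of_continuousOn {g : Space d → F} (hg : ContinuousOn g S) : InteriorContinuous S g :=
  ⟨g, hg, fun _ _ => rfl⟩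

theorem comp {g : Space d → F} (hg : InteriorContinuous S g) {Φ : F → G} (hΦ : Continuous Φ) :
    InteriorContinuous S fun x => Φ (g x) := by
  obtain ⟨h, hc, he⟩ := hg
  exact ⟨fun x => Φ (h x), hΦ.comp_continuousOn hc, fun x hx => congrArg Φ (he hx)⟩

theorem comp₂ {g : Space d → F} {k : Space d → G} (hg : InteriorContinuous S g)
    (hk : InteriorContinuous S k) {Φ : F × G → H} (hΦ : Continuous Φ) :
    InteriorContinuous S fun x => Φ (g x, k x) := by
  obtain ⟨h, hc, he⟩ := hg
  obtain ⟨l, lc, le⟩ := hk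
  exact ⟨fun x => Φ (h x, l x), hΦ.comp_continuousOn (hc.prodMk lc),
    fun x hx => by simp only [he hx, le hx]⟩

theorem add {g k : Space d → F} (hg : InteriorContinuous S g) (hk : InteriorContinuous S k) :
    InteriorContinuous S fun x => g x + k x :=
  hg.comp₂ hk continuous_add

theorem sub {g k : Space d → F} (hg : InteriorContinuous S g) (hk : InteriorContinuous S k) :
    InteriorContinuous S fun x => g x - k x :=
  hg.comp₂ hk continuous_sub

theorem mul {g k : Space d → ℝ} (hg : InteriorContinuous S g) (hk : InteriorContinuous S k) :
    InteriorContinuous S fun x => g x * k x :=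
  hg.comp₂ hk continuous_mul

theorem const_mul {g : Space d → ℝ} (hg : InteriorContinuous S g) (r : ℝ) :
    InteriorContinuous S fun x => r * g x :=
  hg.comp (continuous_const_mul r)

theorem pow {g : Space d → ℝ} (hg : InteriorContinuous S g) (n : ℕ) :
    InteriorContinuous S fun x => g x ^ n :=
  hg.comp (continuous_pow n)

theorem norm_sq {g : Space d → F} (hg : InteriorContinuous S g) :
    InteriorContinuous S fun x => ‖g x‖ ^ 2 :=
  hg.comp (continuous_norm.pow 2)

theorem inner {g k : Space d → Space d} (hg : InteriorContinuous S g)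
    (hk : InteriorContinuous S k) : InteriorContinuous S fun x => inner ℝ (g x) (k x) :=
  hg.comp₂ hk (Φ := fun p : Space d × Space d => Inner.inner ℝ p.1 p.2) continuous_inner

/-- At the frontier `fderiv` depends on values outside `S` and may jump or be a default value. The
derivative within `S` is the continuous representative. -/
theorem fderiv [NormedSpace ℝ F] {g : Space d → F} (hg : ContDiffOn ℝ 1 g S) (hS : Convex ℝ S)
    (hne : (interior S).Nonempty) : InteriorContinuous S (fderiv ℝ g) :=
  ⟨fderivWithin ℝ g S, hg.continuousOn_fderivWithin (uniqueDiffOn_convex hS hne) le_rfl,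
    fun _ hx => (fderivWithin_of_mem_nhds (mem_interior_iff_mem_nhds.1 hx)).symm⟩

theorem divergence {g : Space d → Space d} (hg : ContDiffOn ℝ 1 g S) (hS : Convex ℝ S)
    (hne : (interior S).Nonempty) : InteriorContinuous S (divergence g) :=
  (fderiv hg hS hne).comp
    (Φ := fun M : Space d →L[ℝ] Space d => ∑ i, (M (EuclideanSpace.single i 1)) i) (by fun_prop)

theorem gradient {g : Space d → ℝ} (hg : ContDiffOn ℝ 1 g S) (hS : Convex ℝ S)
    (hne : (interior S).Nonempty) : InteriorContinuous S (gradient g) :=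
  (fderiv hg hS hne).comp (InnerProductSpace.toDual ℝ (Space d)).symm.continuous

theorem laplacian {g : Space d → ℝ} (hg : ContDiffOn ℝ 2 g S) (hS : Convex ℝ S)
    (hne : (interior S).Nonempty) : InteriorContinuous S (Laplacian.laplacian g) := by
  have hu := uniqueDiffOn_convex hS hne
  have h1 : InteriorContinuous S (iteratedFDeriv ℝ 2 g) := by
    refine ⟨iteratedFDerivWithin ℝ 2 g S, hg.continuousOn_iteratedFDerivWithin le_rfl hu,
      fun x hx => ?_⟩
    have hx' := mem_interior_iff_mem_nhds.1 hx
    exact (iteratedFDerivWithin_eq_iteratedFDeriv hu (hg.contDiffAt hx')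
      (interior_subset hx)).symm
  rw [InnerProductSpace.laplacian_eq_iteratedFDeriv_stdOrthonormalBasis]
  exact h1.comp (Φ := fun M : ContinuousMultilinearMap ℝ (fun _ : Fin 2 => Space d) ℝ =>
    ∑ i, M ![stdOrthonormalBasis ℝ (Space d) i, stdOrthonormalBasis ℝ (Space d) i])
    (continuous_finsetSum _ fun i _ => ContinuousEvalConst.continuous_eval_const _)

theorem ae_eq {α : Type*} {g h : Space d → α} (hS : Convex ℝ S) (hc : IsCompact S)
    (he : EqOn g h (interior S)) : g =ᵐ[volume.restrict S] h := by
  rw [Filter.EventuallyEq, ae_restrict_iff' hc.measurableSet]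
  filter_upwards [measure_eq_zero_iff_ae_notMem.1 (hS.addHaar_frontier volume)] with x hx hxS
  refine he ?_
  by_contra hn
  exact hx ⟨subset_closure hxS, hn⟩

theorem integrableOn {g : Space d → F} (hg : InteriorContinuous S g) (hS : Convex ℝ S)
    (hc : IsCompact S) : IntegrableOn g S := by
  obtain ⟨h, hh, he⟩ := hg
  exact (hh.integrableOn_compact hc).congr (ae_eq hS hc he).symm

end InteriorContinuous

/-- The product rule for the divergence. -/
theorem divergence_smul {u : Space d → ℝ} {β : Space d → Space d} {x : Space d}
    (hu : DifferentiableAt ℝ u x) (hβ : DifferentiableAt ℝ β x) :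
    divergence (fun y => u y • β y) x = u x * divergence β x + inner ℝ (β x) (gradient u x) := by
  have hd : HasFDerivAt (fun y => u y • β y) _ x := hu.hasFDerivAt.smul hβ.hasFDerivAt
  have hβx : fderiv ℝ u x (β x) = ∑ i, β x i * fderiv ℝ u x (EuclideanSpace.single i 1) := by
    conv_lhs => rw [← (EuclideanSpace.basisFun (Fin d) ℝ).sum_repr (β x)]
    simp
  rw [divergence, hd.fderiv, divergence, real_inner_comm, gradient,
    InnerProductSpace.toDual_symm_apply, hβx, Finset.mul_sum, ← Finset.sum_add_distrib]
  refine Finset.sum_congr rfl fun i _ => ?_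
  simp
  ring

variable {𝒯 : Triangulation d} {T : ℝ}

/-- A function that vanishes outside the reference domain and is `C²` on each closed cell. -/
structure IsPiecewiseSmooth (𝒯 : Triangulation d) (v : Space d → ℝ) : Prop where
  eq_zero : ∀ Y ∉ 𝒯.region, v Y = 0
  contDiffOn_cell : ∀ K ∈ 𝒯.cells, ContDiffOn ℝ 2 v (convexHull ℝ (K : Set (Space d)))

theorem FESpace.isPiecewiseSmooth {N : ℕ} (V : FESpace 𝒯 N) (U : Fin N → ℝ) :
    IsPiecewiseSmooth 𝒯 (∑ i, U i • V.basis i) where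
  eq_zero Y hY := by simp [V.eq_zero _ Y hY]
  contDiffOn_cell K hK := by
    have : (∑ i, U i • V.basis i) = fun Y => ∑ i, U i * V.basis i Y := by ext; simp
    rw [this]
    exact ContDiffOn.sum fun i _ => contDiffOn_const.mul (V.contDiffOn_cell i K hK)

theorem FESpace.sum_mem_space {N : ℕ} (V : FESpace 𝒯 N) (U : Fin N → ℝ) :
    ∑ i, U i • V.basis i ∈ V.space :=
  Submodule.sum_mem _ fun i _ => Submodule.smul_mem _ _ (Submodule.subset_span ⟨i, rfl⟩)

namespace CellMotion

variable {A : ALEMap 𝒯 T} {K : Finset (Space d)} (m : CellMotion A K) {t : ℝ}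

include m in
theorem push_eq {α : Type*} (ht : t ∈ Icc 0 T) (hK : K ∈ 𝒯.cells) (v : Space d → α) {x : Space d}
    (hx : x ∈ A.cell t K) : A.push t v x = v (m.inv t (x - m.trans t)) := by
  obtain ⟨Y, hY, rfl⟩ := hx
  rw [A.push_map ht v (Triangulation.cell_subset_closedRegion hK hY), m.map_eq t ht Y hY,
    add_sub_cancel_right, m.inv_lin ht]

theorem inv_mem (ht : t ∈ Icc 0 T) {x : Space d} (hx : x ∈ A.cell t K) :
    m.inv t (x - m.trans t) ∈ convexHull ℝ (K : Set (Space d)) := by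
  obtain ⟨Y, hY, rfl⟩ := hx
  rwa [m.map_eq t ht Y hY, add_sub_cancel_right, m.inv_lin ht]

include m in
theorem contDiffOn_push (ht : t ∈ Icc 0 T) (hK : K ∈ 𝒯.cells) {v : Space d → ℝ} {n : ℕ}
    (hv : ContDiffOn ℝ n v (convexHull ℝ (K : Set (Space d)))) :
    ContDiffOn ℝ n (A.push t v) (A.cell t K) := by
  refine ContDiffOn.congr (f := fun x => v (m.inv t (x - m.trans t))) ?_
    fun x hx => m.push_eq ht hK v hx
  exact hv.comp (g := v) (f := fun x => m.inv t (x - m.trans t)) (by fun_prop)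
    fun x hx => m.inv_mem ht hx

theorem derivWithin_map (hT : 0 < T) (ht : t ∈ Icc 0 T) {Y : Space d}
    (hY : Y ∈ convexHull ℝ (K : Set (Space d))) :
    derivWithin (fun s => A.map s Y) (Icc 0 T) t = m.lin' t Y + m.trans' t := by
  have h : HasDerivWithinAt (fun s => m.lin s Y + m.trans s) (m.lin' t Y + m.trans' t)
      (Icc 0 T) t :=
    ((ContinuousLinearMap.apply ℝ (Space d) Y).hasFDerivAt.comp_hasDerivWithinAt t
      (m.hasDeriv_lin t ht)).add (m.hasDeriv_trans t ht)
  exact (h.congr_of_mem (fun s hs => m.map_eq s hs Y hY) ht).derivWithin (uniqueDiffOn_Icc hT t ht)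

theorem velocity_eq (hT : 0 < T) (ht : t ∈ Icc 0 T) (hK : K ∈ 𝒯.cells) {x : Space d}
    (hx : x ∈ A.cell t K) :
    A.velocity t x = m.lin' t (m.inv t (x - m.trans t)) + m.trans' t := by
  rw [ALEMap.velocity, m.push_eq ht hK _ hx, m.derivWithin_map hT ht (m.inv_mem ht hx)]

include m in
theorem contDiffOn_velocity (hT : 0 < T) (ht : t ∈ Icc 0 T) (hK : K ∈ 𝒯.cells) :
    ContDiffOn ℝ 1 (A.velocity t) (A.cell t K) := by
  refine ContDiffOn.congr (f := fun x => m.lin' t (m.inv t (x - m.trans t)) + m.trans' t) ?_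
    fun x hx => m.velocity_eq hT ht hK hx
  fun_prop

/-- The velocity is affine on the cell, so its divergence is the trace of a constant matrix. It is
the same trace that Jacobi's formula produces. -/
theorem divergence_velocity (hT : 0 < T) (ht : t ∈ Icc 0 T) (hK : K ∈ 𝒯.cells) {x : Space d}
    (hx : x ∈ interior (A.cell t K)) :
    divergence (A.velocity t) x = ∑ i, (m.lin' t (m.inv t (EuclideanSpace.single i 1))) i := by
  have h : HasFDerivAt (fun x => m.lin' t (m.inv t (x - m.trans t)) + m.trans' t)
      ((m.lin' t).comp (m.inv t)) x :=
    (((m.lin' t).comp (m.inv t)).hasFDerivAt.comp x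
      ((hasFDerivAt_id x).sub_const (m.trans t))).add_const (m.trans' t)
  have he : A.velocity t =ᶠ[nhds x]
      fun x => m.lin' t (m.inv t (x - m.trans t)) + m.trans' t := by
    filter_upwards [mem_interior_iff_mem_nhds.1 hx] with y hy using m.velocity_eq hT ht hK hy
  rw [divergence, he.fderiv_eq, h.fderiv]
  rfl

end CellMotion

namespace ALEMap

variable (A : ALEMap 𝒯 T) {t : ℝ}

theorem push_eq_zero (ht : t ∈ Icc 0 T) {v : Space d → ℝ} (hv : ∀ Y ∉ 𝒯.region, v Y = 0)
    {x : Space d} (hx : x ∈ A.closedDomain t) (hx' : x ∉ A.domain t) : A.push t v x = 0 := by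
  obtain ⟨Y, hY, rfl⟩ := hx
  rw [A.push_map ht v hY]
  exact hv Y fun h => hx' ⟨Y, h, rfl⟩

/-- The divergence theorem on the moving domain for a vector field that is Lipschitz on each cell
and vanishes on the boundary. -/
theorem integral_divergence_domain (hT : 0 < T) (ht : t ∈ Icc 0 T) {g : Space d → Space d}
    (hg : ∀ K ∈ 𝒯.cells, ∃ C, LipschitzOnWith C g (A.cell t K))
    (h0 : ∀ x ∈ A.closedDomain t, x ∉ A.domain t → g x = 0) :
    ∫ x in A.domain t, divergence g x = 0 := by
  have hcd := A.isCompact_closedDomain hT ht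
  have hopen := A.isOpen_image t ht
  choose! C hC using hg
  set h := (A.closedDomain t).indicator g with hh
  have hlip : LipschitzWith (𝒯.cells.sup C) h := by
    -- The cover consists of the cells and, as the `none` piece, the closed complement of the
    -- domain, where the zero extension vanishes.
    refine lipschitzWith_of_finite_closed_cover
      (S := fun o : Option 𝒯.cells => o.elim (A.domain t)ᶜ fun K => A.cell t K) ?_ ?_ ?_
    · rintro (_ | K)
      · exact hopen.isClosed_compl
      · exact ((exists_cellMotion hT A K.2).some.isCompact_cell ht).isClosed
    · refine eq_univ_of_forall fun x => ?_
      by_cases hx : x ∈ A.domain t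
      · have hx' := A.domain_subset_closedDomain hx
        rw [closedDomain_eq_iUnion] at hx'
        obtain ⟨K, hK⟩ := mem_iUnion.1 hx'
        exact mem_iUnion.2 ⟨some K, hK⟩
      · exact mem_iUnion.2 ⟨none, hx⟩
    · rintro (_ | K)
      · have hz : ∀ x ∈ (A.domain t)ᶜ, h x = 0 := by
          intro x hx
          by_cases hx' : x ∈ A.closedDomain t
          · rw [hh, indicator_of_mem hx', h0 x hx' hx]
          · rw [hh, indicator_of_notMem hx']
        intro x hx y hy
        rw [hz x hx, hz y hy]
        simp
      · have hle := (hC K K.2).weaken (Finset.le_sup K.2 : C K ≤ 𝒯.cells.sup C)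
        intro x hx y hy
        rw [hh, indicator_of_mem (A.cell_subset_closedDomain K.2 hx),
          indicator_of_mem (A.cell_subset_closedDomain K.2 hy)]
        exact hle hx hy
  have hsupp : HasCompactSupport h :=
    HasCompactSupport.intro hcd fun x hx => indicator_of_notMem hx _
  have hint := integral_divergence_eq_zero hlip hsupp
  have hout : ∀ x ∉ A.closedDomain t, divergence h x = 0 := by
    intro x hx
    have he : h =ᶠ[nhds x] fun _ => 0 := by
      filter_upwards [hcd.isClosed.isOpen_compl.mem_nhds hx] with y hy
        using indicator_of_notMem hy _
    simp [divergence, he.fderiv_eq]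
  rw [← setIntegral_eq_integral_of_forall_compl_eq_zero hout,
    ← setIntegral_congr_set (A.domain_ae_eq hT ht)] at hint
  rw [← hint]
  refine setIntegral_congr_fun hopen.measurableSet fun x hx => ?_
  have he : h =ᶠ[nhds x] g := by
    filter_upwards [hopen.mem_nhds hx] with y hy
      using indicator_of_mem (A.domain_subset_closedDomain hy) _
  simp only [divergence, he.fderiv_eq]

theorem integral_domain_congr (hT : 0 < T) (ht : t ∈ Icc 0 T) {g h : Space d → F} [NormedSpace ℝ F]
    (hgh : ∀ K ∈ 𝒯.cells, ∀ x ∈ interior (A.cell t K), g x = h x) :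
    ∫ x in A.domain t, g x = ∫ x in A.domain t, h x := by
  refine setIntegral_congr_ae (A.isOpen_image t ht).measurableSet ?_
  filter_upwards [A.ae_mem_interior_cell hT ht] with x hx hxd
  obtain ⟨K, hK, hxK⟩ := hx (A.domain_subset_closedDomain hxd)
  exact hgh K hK x hxK

theorem integrableOn_domain_of_interiorContinuous (hT : 0 < T) (ht : t ∈ Icc 0 T)
    {g : Space d → F} (hg : ∀ K ∈ 𝒯.cells, InteriorContinuous (A.cell t K) g) :
    IntegrableOn g (A.domain t) :=
  A.integrableOn_domain hT ht fun K hK =>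
    let m := (exists_cellMotion hT A hK).some
    (hg K hK).integrableOn (m.convex_cell ht) (m.isCompact_cell ht)

theorem integral_domain_of_interiorContinuous (hT : 0 < T) (ht : t ∈ Icc 0 T) {g : Space d → ℝ}
    (hg : ∀ K ∈ 𝒯.cells, InteriorContinuous (A.cell t K) g) :
    ∫ x in A.domain t, g x = ∑ K ∈ 𝒯.cells, ∫ x in A.cell t K, g x :=
  A.integral_domain hT ht fun K hK =>
    let m := (exists_cellMotion hT A hK).some
    (hg K hK).integrableOn (m.convex_cell ht) (m.isCompact_cell ht)

/-- Integration by parts in the convective term. -/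
theorem integral_inner_gradient_mul (hT : 0 < T) (ht : t ∈ Icc 0 T) {v : Space d → ℝ}
    (hv : IsPiecewiseSmooth 𝒯 v) {β : Space d → Space d}
    (hβ : ∀ K ∈ 𝒯.cells, ContDiffOn ℝ 1 β (A.cell t K)) :
    ∫ x in A.domain t, inner ℝ (β x) (gradient (A.push t v) x) * A.push t v x
      = -(1 / 2) * ∫ x in A.domain t, divergence β x * A.push t v x ^ 2 := by
  set u := A.push t v with hu
  have m : ∀ K ∈ 𝒯.cells, CellMotion A K := fun K hK => (exists_cellMotion hT A hK).some
  have hu1 : ∀ K ∈ 𝒯.cells, ContDiffOn ℝ 1 u (A.cell t K) := fun K hK =>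
    ((m K hK).contDiffOn_push ht hK (hv.contDiffOn_cell K hK)).of_le one_le_two
  have hne : ∀ K ∈ 𝒯.cells, (interior (A.cell t K)).Nonempty := fun K hK =>
    (m K hK).interior_cell_nonempty ht hK
  have hcv : ∀ K ∈ 𝒯.cells, Convex ℝ (A.cell t K) := fun K hK => (m K hK).convex_cell ht
  -- The field u²β vanishes on the boundary because `u` does. Its divergence is u² div β + 2u β·∇u.
  have h1 : ∫ x in A.domain t, divergence (fun x => u x ^ 2 • β x) x = 0 := by
    refine A.integral_divergence_domain hT ht (fun K hK => ?_) fun x hx hx' => ?_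
    · exact (((hu1 K hK).pow 2).smul (hβ K hK)).exists_lipschitzOnWith one_ne_zero
        (hcv K hK) ((m K hK).isCompact_cell ht)
    · simp [hu, A.push_eq_zero ht hv.eq_zero hx hx']
  have h2 : ∫ x in A.domain t, divergence (fun x => u x ^ 2 • β x) x
      = ∫ x in A.domain t,
        (divergence β x * u x ^ 2 + 2 * (inner ℝ (β x) (gradient u x) * u x)) := by
    refine A.integral_domain_congr hT ht fun K hK x hx => ?_
    have hx' := mem_interior_iff_mem_nhds.1 hx
    have hud := ((hu1 K hK).contDiffAt hx').differentiableAt one_ne_zero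
    have hβd := ((hβ K hK).contDiffAt hx').differentiableAt one_ne_zero
    have hsq : HasFDerivAt (fun x => u x ^ 2) _ x := hud.hasFDerivAt.pow 2
    rw [divergence_smul hsq.differentiableAt hβd, gradient, gradient, hsq.fderiv, map_smul,
      real_inner_smul_right]
    simp only [Nat.add_one_sub_one, pow_one, nsmul_eq_mul, Nat.cast_ofNat]
    ring
  have hr1 : IntegrableOn (fun x => divergence β x * u x ^ 2) (A.domain t) :=
    A.integrableOn_domain_of_interiorContinuous hT ht fun K hK =>
      (InteriorContinuous.divergence (hβ K hK) (hcv K hK) (hne K hK)).mul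
        ((InteriorContinuous.of_continuousOn (hu1 K hK).continuousOn).pow 2)
  have hr2 : IntegrableOn (fun x => 2 * (inner ℝ (β x) (gradient u x) * u x)) (A.domain t) :=
    A.integrableOn_domain_of_interiorContinuous hT ht fun K hK =>
      (((InteriorContinuous.of_continuousOn (hβ K hK).continuousOn).inner
        (InteriorContinuous.gradient (hu1 K hK) (hcv K hK) (hne K hK))).mul
        (InteriorContinuous.of_continuousOn (hu1 K hK).continuousOn)).const_mul 2
  rw [h2, integral_add hr1 hr2, integral_const_mul] at h1
  linarith

end ALEMap

end

/-! ### The mass form and Reynolds' transport theorem. -/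

section

variable {d N : ℕ} {𝒯 : Triangulation d} {T : ℝ}

theorem l2Norm_nonneg {F : Type*} [NormedAddCommGroup F] (S : Set (Space d)) (g : Space d → F) :
    0 ≤ l2Norm S g :=
  Real.sqrt_nonneg _

theorem l2Norm_sq {F : Type*} [NormedAddCommGroup F] (S : Set (Space d)) (g : Space d → F) :
    l2Norm S g ^ 2 = ∫ x in S, ‖g x‖ ^ 2 :=
  Real.sq_sqrt (integral_nonneg fun _ => sq_nonneg _)

theorem l2Norm_sq_real (S : Set (Space d)) (g : Space d → ℝ) :
    l2Norm S g ^ 2 = ∫ x in S, g x ^ 2 := by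
  simp [l2Norm_sq]

/-- The contribution of a reference cell to the mass form. -/
def massForm (V : FESpace 𝒯 N) (K : Finset (Space d)) (a b : Fin N → ℝ) : ℝ :=
  ∑ i, ∑ j, a i * b j * ∫ Y in convexHull ℝ (K : Set (Space d)), V.basis i Y * V.basis j Y

theorem integral_cell_sum_mul_sum (V : FESpace 𝒯 N) (K : Finset (Space d)) (a b : Fin N → ℝ) :
    ∫ Y in convexHull ℝ (K : Set (Space d)),
      (∑ i, a i • V.basis i) Y * (∑ i, b i • V.basis i) Y = massForm V K a b := by
  have h : ∀ i j, IntegrableOn (fun Y => V.basis i Y * V.basis j Y)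
      (convexHull ℝ (K : Set (Space d))) := fun i j =>
    ((V.continuous i).mul (V.continuous j)).continuousOn.integrableOn_compact
      (Triangulation.isCompact_convexHull K)
  have h' : ∀ Y, (∑ i, a i • V.basis i) Y * (∑ i, b i • V.basis i) Y
      = ∑ i, ∑ j, a i * b j * (V.basis i Y * V.basis j Y) := by
    intro Y
    simp only [Finset.sum_apply, Pi.smul_apply, smul_eq_mul, Finset.sum_mul_sum]
    refine Finset.sum_congr rfl fun i _ => Finset.sum_congr rfl fun j _ => by ring
  simp only [h']
  rw [integral_finsetSum _ fun i _ => integrable_finsetSum _ fun j _ => (h i j).const_mul _]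
  refine Finset.sum_congr rfl fun i _ => ?_
  rw [integral_finsetSum _ fun j _ => (h i j).const_mul _]
  exact Finset.sum_congr rfl fun j _ => integral_const_mul _ _

namespace CellMotion

variable {A : ALEMap 𝒯 T} {K : Finset (Space d)} (m : CellMotion A K) {t : ℝ}

/-- The absolute value of the Jacobian determinant. -/
def jac (t : ℝ) : ℝ := |(m.lin t).det|

/-- The divergence of the mesh velocity on the cell. -/
def divVelocity (t : ℝ) : ℝ := ∑ i, (m.lin' t (m.inv t (EuclideanSpace.single i 1))) i

theorem hasDerivWithinAt_jac (ht : t ∈ Icc 0 T) :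
    HasDerivWithinAt m.jac (m.jac t * m.divVelocity t) (Icc 0 T) t :=
  hasDerivWithinAt_abs_det (m.hasDeriv_lin t ht) (m.lin_inv ht) (m.det_ne_zero t ht)

/-- The Jacobian is constant in space, so the time dependence sits in `jac` and the coefficients.
Differentiating in time then requires no differentiation under the integral. -/
theorem integral_cell_push_mul_push (V : FESpace 𝒯 N) (ht : t ∈ Icc 0 T) (hK : K ∈ 𝒯.cells)
    (a b : Fin N → ℝ) :
    ∫ x in A.cell t K, A.push t (∑ i, a i • V.basis i) x * A.push t (∑ i, b i • V.basis i) x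
      = m.jac t * massForm V K a b := by
  rw [m.integral_cell ht, ← integral_cell_sum_mul_sum, ← integral_const_mul]
  refine setIntegral_congr_fun (Triangulation.isCompact_convexHull K).measurableSet
    fun Y hY => ?_
  have hY' := Triangulation.cell_subset_closedRegion hK hY
  simp only [← m.map_eq t ht Y hY, A.push_map ht _ hY', jac, smul_eq_mul]

end CellMotion

/-- A choice of affine representations on all the cells. -/
def ALEMap.motion (A : ALEMap 𝒯 T) (hT : 0 < T) (K : 𝒯.cells) : CellMotion A (K : Finset (Space d)) :=
  (exists_cellMotion hT A K.2).some

section Mass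

variable (A : ALEMap 𝒯 T) (V : FESpace 𝒯 N) {t : ℝ}

theorem interiorContinuous_push (hT : 0 < T) (ht : t ∈ Icc 0 T) {v : Space d → ℝ}
    (hv : IsPiecewiseSmooth 𝒯 v) {K : Finset (Space d)} (hK : K ∈ 𝒯.cells) :
    InteriorContinuous (A.cell t K) (A.push t v) :=
  .of_continuousOn
    ((A.motion hT ⟨K, hK⟩).contDiffOn_push ht hK (hv.contDiffOn_cell K hK)).continuousOn

theorem integral_domain_push_mul_push (hT : 0 < T) (ht : t ∈ Icc 0 T) (a b : Fin N → ℝ) :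
    ∫ x in A.domain t, A.push t (∑ i, a i • V.basis i) x * A.push t (∑ i, b i • V.basis i) x
      = ∑ K : 𝒯.cells, (A.motion hT K).jac t * massForm V K a b := by
  rw [A.integral_domain_of_interiorContinuous hT ht fun K hK =>
    (interiorContinuous_push A hT ht (V.isPiecewiseSmooth a) hK).mul
      (interiorContinuous_push A hT ht (V.isPiecewiseSmooth b) hK), ← Finset.sum_coe_sort]
  exact Finset.sum_congr rfl fun K _ => (A.motion hT K).integral_cell_push_mul_push V ht K.2 a b

theorem integral_domain_divergence_velocity (hT : 0 < T) (ht : t ∈ Icc 0 T) (a : Fin N → ℝ) :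
    ∫ x in A.domain t, divergence (A.velocity t) x * A.push t (∑ i, a i • V.basis i) x ^ 2
      = ∑ K : 𝒯.cells,
        (A.motion hT K).jac t * (A.motion hT K).divVelocity t * massForm V K a a := by
  have hcv : ∀ K : 𝒯.cells, Convex ℝ (A.cell t K) := fun K => (A.motion hT K).convex_cell ht
  rw [A.integral_domain_of_interiorContinuous hT ht fun K hK =>
    (InteriorContinuous.divergence ((A.motion hT ⟨K, hK⟩).contDiffOn_velocity hT ht hK)
      (hcv ⟨K, hK⟩) ((A.motion hT ⟨K, hK⟩).interior_cell_nonempty ht hK)).mul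
      ((interiorContinuous_push A hT ht (V.isPiecewiseSmooth a) hK).pow 2), ← Finset.sum_coe_sort]
  refine Finset.sum_congr rfl fun K _ => ?_
  rw [mul_right_comm, ← (A.motion hT K).integral_cell_push_mul_push V ht K.2, mul_comm,
    ← integral_const_mul]
  refine integral_congr_ae (InteriorContinuous.ae_eq (hcv K)
    ((A.motion hT K).isCompact_cell ht) fun x hx => ?_)
  simp only [(A.motion hT K).divergence_velocity hT ht K.2 hx, CellMotion.divVelocity]
  ring

variable {U : ℝ → Fin N → ℝ}

theorem hasDerivWithinAt_massForm_left {K : Finset (Space d)} {U' b : Fin N → ℝ} {s : Set ℝ}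
    (hU : HasDerivWithinAt U U' s t) :
    HasDerivWithinAt (fun r => massForm V K (U r) b) (massForm V K U' b) s t := by
  refine HasDerivWithinAt.fun_sum fun i _ => HasDerivWithinAt.fun_sum fun j _ => ?_
  exact ((hasDerivWithinAt_pi.1 hU i).mul_const _).mul_const _

theorem massForm_comm (K : Finset (Space d)) (a b : Fin N → ℝ) :
    massForm V K a b = massForm V K b a := by
  rw [massForm, Finset.sum_comm]
  refine Finset.sum_congr rfl fun i _ => Finset.sum_congr rfl fun j _ => ?_
  simp only [mul_comm (V.basis j _), mul_comm (a j)]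

theorem hasDerivWithinAt_massForm_self {K : Finset (Space d)} {U' : Fin N → ℝ} {s : Set ℝ}
    (hU : HasDerivWithinAt U U' s t) :
    HasDerivWithinAt (fun r => massForm V K (U r) (U r)) (2 * massForm V K U' (U t)) s t := by
  have h : HasDerivWithinAt (fun r => massForm V K (U r) (U r))
      (massForm V K U' (U t) + massForm V K (U t) U') s t := by
    simp only [massForm, ← Finset.sum_add_distrib]
    refine HasDerivWithinAt.fun_sum fun i _ => HasDerivWithinAt.fun_sum fun j _ => ?_
    exact (((hasDerivWithinAt_pi.1 hU i).mul (hasDerivWithinAt_pi.1 hU j)).mul_const _).congr_deriv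
      (by ring)
  exact h.congr_deriv (by rw [massForm_comm V K (U t)]; ring)

theorem continuousOn_massForm_self {K : Finset (Space d)} {s : Set ℝ} (hU : ContinuousOn U s) :
    ContinuousOn (fun r => massForm V K (U r) (U r)) s := by
  have hi : ∀ i, ContinuousOn (fun r => U r i) s := fun i => continuousOn_pi.1 hU i
  exact continuousOn_finsetSum _ fun i _ => continuousOn_finsetSum _ fun j _ =>
    ((hi i).mul (hi j)).mul continuousOn_const

theorem l2Norm_feFunction_sq (hT : 0 < T) (ht : t ∈ Icc 0 T) :
    l2Norm (A.domain t) (feFunction A V U t) ^ 2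
      = ∑ K : 𝒯.cells, (A.motion hT K).jac t * massForm V K (U t) (U t) := by
  rw [l2Norm_sq_real, ← integral_domain_push_mul_push A V hT ht]
  simp only [feFunction, sq]

theorem continuousOn_l2Norm_feFunction_sq (hT : 0 < T) (hU : ContinuousOn U (Icc 0 T)) :
    ContinuousOn (fun t => l2Norm (A.domain t) (feFunction A V U t) ^ 2) (Icc 0 T) := by
  refine ContinuousOn.congr ?_ fun t ht => l2Norm_feFunction_sq A V hT ht
  exact continuousOn_finsetSum _ fun K _ => (A.motion hT K).continuousOn_abs_det.mul
    (continuousOn_massForm_self V hU)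

/-- Reynolds' transport theorem for the square of the `L²` norm of a finite element function. -/
theorem hasDerivWithinAt_l2Norm_feFunction_sq (hT : 0 < T) (ht : t ∈ Icc 0 T)
    (hU : DifferentiableWithinAt ℝ U (Icc 0 T) t) {D : ℝ}
    (hD : HasDerivWithinAt (fun s => ∫ x in A.domain s,
      feFunction A V U s x * A.push s (∑ i, U t i • V.basis i) x) D (Icc 0 T) t) :
    HasDerivWithinAt (fun s => l2Norm (A.domain s) (feFunction A V U s) ^ 2)
      (2 * D - ∫ x in A.domain t, divergence (A.velocity t) x * feFunction A V U t x ^ 2)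
      (Icc 0 T) t := by
  have hU' := hU.hasDerivWithinAt
  set U' := derivWithin U (Icc 0 T) t
  have hD' : HasDerivWithinAt (fun s => ∫ x in A.domain s,
      feFunction A V U s x * A.push s (∑ i, U t i • V.basis i) x)
      (∑ K : 𝒯.cells, ((A.motion hT K).jac t * (A.motion hT K).divVelocity t
        * massForm V K (U t) (U t) + (A.motion hT K).jac t * massForm V K U' (U t)))
      (Icc 0 T) t := by
    refine HasDerivWithinAt.congr_of_mem (f := fun s => ∑ K : 𝒯.cells,
      (A.motion hT K).jac s * massForm V K (U s) (U t)) ?_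
      (fun s hs => integral_domain_push_mul_push A V hT hs (U s) (U t)) ht
    exact HasDerivWithinAt.fun_sum fun K _ => ((A.motion hT K).hasDerivWithinAt_jac ht).mul
      (hasDerivWithinAt_massForm_left V hU')
  have hDeq := (uniqueDiffOn_Icc hT t ht).eq_deriv _ hD hD'
  -- The square contains the varying coefficients twice and the frozen form contains them once,
  -- while both differentiate the Jacobian once. Thus `2 * D` has one Jacobian term too many, which
  -- is the integral of (div w) u².
  have hE : HasDerivWithinAt (fun s => l2Norm (A.domain s) (feFunction A V U s) ^ 2)
      (∑ K : 𝒯.cells, ((A.motion hT K).jac t * (A.motion hT K).divVelocity t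
        * massForm V K (U t) (U t) + (A.motion hT K).jac t * (2 * massForm V K U' (U t))))
      (Icc 0 T) t := by
    refine HasDerivWithinAt.congr_of_mem (f := fun s => ∑ K : 𝒯.cells,
      (A.motion hT K).jac s * massForm V K (U s) (U s)) ?_
      (fun s hs => l2Norm_feFunction_sq A V hT hs) ht
    exact HasDerivWithinAt.fun_sum fun K _ => ((A.motion hT K).hasDerivWithinAt_jac ht).mul
      (hasDerivWithinAt_massForm_self V hU')
  refine hE.congr_deriv ?_
  rw [hDeq, feFunction, integral_domain_divergence_velocity A V hT ht, Finset.mul_sum,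
    ← Finset.sum_sub_distrib]
  exact Finset.sum_congr rfl fun K _ => by ring

/-- The conservative mesh velocity term tested with the solution itself. -/
theorem integral_divergence_smul_velocity (hT : 0 < T) (ht : t ∈ Icc 0 T) {v : Space d → ℝ}
    (hv : IsPiecewiseSmooth 𝒯 v) :
    ∫ x in A.domain t, divergence (fun y => A.push t v y • A.velocity t y) x * A.push t v x
      = 1 / 2 * ∫ x in A.domain t, divergence (A.velocity t) x * A.push t v x ^ 2 := by
  set u := A.push t v with hu
  have hw : ∀ K ∈ 𝒯.cells, ContDiffOn ℝ 1 (A.velocity t) (A.cell t K) := fun K hK =>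
    (A.motion hT ⟨K, hK⟩).contDiffOn_velocity hT ht hK
  have hu1 : ∀ K ∈ 𝒯.cells, ContDiffOn ℝ 1 u (A.cell t K) := fun K hK =>
    ((A.motion hT ⟨K, hK⟩).contDiffOn_push ht hK (hv.contDiffOn_cell K hK)).of_le one_le_two
  have hne : ∀ K ∈ 𝒯.cells, (interior (A.cell t K)).Nonempty := fun K hK =>
    (A.motion hT ⟨K, hK⟩).interior_cell_nonempty ht hK
  have hcv : ∀ K ∈ 𝒯.cells, Convex ℝ (A.cell t K) := fun K hK =>
    (A.motion hT ⟨K, hK⟩).convex_cell ht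
  have h2 : ∫ x in A.domain t, divergence (fun y => u y • A.velocity t y) x * u x
      = ∫ x in A.domain t, (divergence (A.velocity t) x * u x ^ 2
        + inner ℝ (A.velocity t x) (gradient u x) * u x) := by
    refine A.integral_domain_congr hT ht fun K hK x hx => ?_
    have hx' := mem_interior_iff_mem_nhds.1 hx
    have hud := ((hu1 K hK).contDiffAt hx').differentiableAt one_ne_zero
    have hwd := ((hw K hK).contDiffAt hx').differentiableAt one_ne_zero
    rw [divergence_smul hud hwd]
    ring
  have hr1 : IntegrableOn (fun x => divergence (A.velocity t) x * u x ^ 2) (A.domain t) :=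
    A.integrableOn_domain_of_interiorContinuous hT ht fun K hK =>
      (InteriorContinuous.divergence (hw K hK) (hcv K hK) (hne K hK)).mul
        ((interiorContinuous_push A hT ht hv hK).pow 2)
  have hr2 : IntegrableOn (fun x => inner ℝ (A.velocity t x) (gradient u x) * u x) (A.domain t) :=
    A.integrableOn_domain_of_interiorContinuous hT ht fun K hK =>
      ((InteriorContinuous.of_continuousOn (hw K hK).continuousOn).inner
        (InteriorContinuous.gradient (hu1 K hK) (hcv K hK) (hne K hK))).mul
        (interiorContinuous_push A hT ht hv hK)
  -- The transport part w·∇u u integrates to minus one half of the (div w) u² part, leaving one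
  -- half.
  rw [h2, integral_add hr1 hr2, A.integral_inner_gradient_mul hT ht hv hw]
  ring

end Mass

end

/-! ### Coercivity and the estimate at a fixed time. -/

section

variable {d N : ℕ} {𝒯 : Triangulation d} {T : ℝ}

theorem abs_le_supNorm {S : Set (Space d)} (hS : IsCompact S) {g : Space d → ℝ}
    (hg : ContinuousOn g S) {x : Space d} (hx : x ∈ S) : |g x| ≤ supNorm S g :=
  le_csSup (hS.image_of_continuousOn hg.abs).bddAbove ⟨x, hx, rfl⟩

/-- The terms of the stabilized scheme on a cell are controlled by the residual terms. -/
theorem stabilization_ge {S : Set (Space d)} (hS : Convex ℝ S) (hc : IsCompact S)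
    {ε C : ℝ} {lap s c u : Space d → ℝ} (hlap : InteriorContinuous S lap)
    (hs : InteriorContinuous S s) (hcc : InteriorContinuous S c) (hu : InteriorContinuous S u)
    (hC : ∀ x ∈ S, |c x| ≤ C) :
    1 / 2 * (∫ x in S, s x ^ 2) - ε ^ 2 * (∫ x in S, lap x ^ 2) - C ^ 2 * (∫ x in S, u x ^ 2)
      ≤ ∫ x in S, (-ε * lap x + s x + c x * u x) * s x := by
  have h1 := (hs.pow 2).const_mul (1 / 2)
  have h2 := (hlap.pow 2).const_mul (ε ^ 2)
  have h3 := (hu.pow 2).const_mul (C ^ 2)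
  rw [← integral_const_mul, ← integral_const_mul, ← integral_const_mul,
    ← integral_sub (h1.integrableOn hS hc) (h2.integrableOn hS hc),
    ← integral_sub ((h1.sub h2).integrableOn hS hc) (h3.integrableOn hS hc)]
  refine setIntegral_mono_on (((h1.sub h2).sub h3).integrableOn hS hc)
    ((((((hlap.const_mul (-ε)).add hs).add (hcc.mul hu)).mul hs)).integrableOn hS hc)
    hc.measurableSet fun x hx => ?_
  have hcu : (c x * u x) ^ 2 ≤ C ^ 2 * u x ^ 2 := by
    rw [mul_pow]
    exact mul_le_mul_of_nonneg_right
      (sq_le_sq' (neg_le_of_abs_le (hC x hx)) (le_of_abs_le (hC x hx))) (sq_nonneg _)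
  -- Each of the two cross terms costs a quarter of s², leaving the half on the left.
  nlinarith [sq_nonneg (1 / 2 * s x - ε * lap x), sq_nonneg (1 / 2 * s x + c x * u x)]

/-- Young's inequality, used with `r = μ` for the Galerkin load and `r = 1` for the stabilized load.
-/
theorem integral_mul_le {S : Set (Space d)} (hS : Convex ℝ S) (hc : IsCompact S) {r : ℝ}
    (hr : 0 < r) {f s : Space d → ℝ} (hf : InteriorContinuous S f) (hs : InteriorContinuous S s) :
    ∫ x in S, f x * s x ≤ r⁻¹ * (∫ x in S, f x ^ 2) + r / 4 * ∫ x in S, s x ^ 2 := by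
  have h1 := (hf.pow 2).const_mul r⁻¹
  have h2 := (hs.pow 2).const_mul (r / 4)
  rw [← integral_const_mul, ← integral_const_mul,
    ← integral_add (h1.integrableOn hS hc) (h2.integrableOn hS hc)]
  refine setIntegral_mono_on ((hf.mul hs).integrableOn hS hc)
    ((h1.add h2).integrableOn hS hc) hc.measurableSet fun x _ => ?_
  have h : r⁻¹ * f x ^ 2 + r / 4 * s x ^ 2 - f x * s x = r⁻¹ * (f x - r / 2 * s x) ^ 2 := by
    field_simp
    ring
  have h' : 0 ≤ r⁻¹ * (f x - r / 2 * s x) ^ 2 := by positivity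
  linarith

variable {A : ALEMap 𝒯 T} {ε μ cinv : ℝ} {b : ℝ → Space d → Space d} {c f : ℝ → Space d → ℝ}
  {δ : ℝ → Finset (Space d) → ℝ} {t : ℝ}

theorem continuousOn_cell_of_spaceTime {F : Type*} [TopologicalSpace F] {g : ℝ → Space d → F}
    (hg : ContinuousOn (fun p : ℝ × Space d => g p.1 p.2) A.spaceTime) (ht : t ∈ Icc 0 T)
    {K : Finset (Space d)} (hK : K ∈ 𝒯.cells) : ContinuousOn (g t) (A.cell t K) :=
  hg.comp (f := fun x => (t, x)) (by fun_prop)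
    fun _ hx => ⟨ht, A.cell_subset_closedDomain hK hx⟩

theorem interiorContinuous_gradient_push (hT : 0 < T) (ht : t ∈ Icc 0 T) {v : Space d → ℝ}
    (hv : IsPiecewiseSmooth 𝒯 v) {K : Finset (Space d)} (hK : K ∈ 𝒯.cells) :
    InteriorContinuous (A.cell t K) (gradient (A.push t v)) :=
  let m := A.motion hT ⟨K, hK⟩
  .gradient ((m.contDiffOn_push ht hK (hv.contDiffOn_cell K hK)).of_le one_le_two)
    (m.convex_cell ht) (m.interior_cell_nonempty ht hK)

theorem interiorContinuous_streamline (hT : 0 < T) (ht : t ∈ Icc 0 T)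
    (hb : ContinuousOn (fun p : ℝ × Space d => b p.1 p.2) A.spaceTime) {v : Space d → ℝ}
    (hv : IsPiecewiseSmooth 𝒯 v) {K : Finset (Space d)} (hK : K ∈ 𝒯.cells) :
    InteriorContinuous (A.cell t K) (streamline A b t (A.push t v)) :=
  ((InteriorContinuous.of_continuousOn (continuousOn_cell_of_spaceTime hb ht hK)).sub
    (.of_continuousOn
      ((A.motion hT ⟨K, hK⟩).contDiffOn_velocity hT ht hK).continuousOn)).inner
    (interiorContinuous_gradient_push hT ht hv hK)

/-- Coercivity of the convection-reaction part of the bilinear form. -/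
theorem convection_reaction_ge (hT : 0 < T) (ht : t ∈ Icc 0 T)
    (hb' : ContDiffOn ℝ 1 (b t) (A.closedDomain t))
    (hc : ContinuousOn (fun p : ℝ × Space d => c p.1 p.2) A.spaceTime)
    (hcoer : ∀ x ∈ A.domain t, μ ≤ c t x - 1 / 2 * divergence (b t) x)
    {v : Space d → ℝ} (hv : IsPiecewiseSmooth 𝒯 v) :
    μ * (∫ x in A.domain t, A.push t v x ^ 2)
      ≤ (∫ x in A.domain t, inner ℝ (b t x) (gradient (A.push t v) x) * A.push t v x)
        + ∫ x in A.domain t, c t x * A.push t v x * A.push t v x := by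
  have hβ : ∀ K ∈ 𝒯.cells, ContDiffOn ℝ 1 (b t) (A.cell t K) := fun K hK =>
    hb'.mono (A.cell_subset_closedDomain hK)
  have hu := fun K hK => interiorContinuous_push A hT ht hv (K := K) hK
  have h1 : ∀ K ∈ 𝒯.cells, InteriorContinuous (A.cell t K)
      (fun x => 1 / 2 * (divergence (b t) x * A.push t v x ^ 2)) := fun K hK =>
    (((InteriorContinuous.divergence (hβ K hK) ((A.motion hT ⟨K, hK⟩).convex_cell ht)
      ((A.motion hT ⟨K, hK⟩).interior_cell_nonempty ht hK)).mul ((hu K hK).pow 2)).const_mul _)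
  have h2 : ∀ K ∈ 𝒯.cells, InteriorContinuous (A.cell t K)
      (fun x => c t x * A.push t v x * A.push t v x) := fun K hK =>
    ((InteriorContinuous.of_continuousOn (continuousOn_cell_of_spaceTime hc ht hK)).mul
      (hu K hK)).mul (hu K hK)
  rw [A.integral_inner_gradient_mul hT ht hv hβ, neg_mul, neg_add_eq_sub, ← integral_const_mul,
    ← integral_const_mul,
    ← integral_sub (A.integrableOn_domain_of_interiorContinuous hT ht h2)
      (A.integrableOn_domain_of_interiorContinuous hT ht h1)]
  refine setIntegral_mono_on
    (A.integrableOn_domain_of_interiorContinuous hT ht fun K hK => ((hu K hK).pow 2).const_mul μ)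
    (A.integrableOn_domain_of_interiorContinuous hT ht fun K hK => (h2 K hK).sub (h1 K hK))
    (A.isOpen_image t ht).measurableSet fun x hx => ?_
  nlinarith [mul_le_mul_of_nonneg_right (hcoer x hx) (sq_nonneg (A.push t v x))]

/-- Stability of the stationary part of the scheme at a fixed time. -/
theorem load_sub_aSUPG_le (hT : 0 < T) (ht : t ∈ Icc 0 T) (hε : 0 < ε) (hμ : 0 < μ)
    (hb : ContinuousOn (fun p : ℝ × Space d => b p.1 p.2) A.spaceTime)
    (hb' : ContDiffOn ℝ 1 (b t) (A.closedDomain t))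
    (hc : ContinuousOn (fun p : ℝ × Space d => c p.1 p.2) A.spaceTime)
    (hf : ContinuousOn (fun p : ℝ × Space d => f p.1 p.2) A.spaceTime)
    (hcoer : ∀ x ∈ A.domain t, μ ≤ c t x - 1 / 2 * divergence (b t) x)
    (hδ : ∀ K ∈ 𝒯.cells, 0 ≤ δ t K)
    (hδ_c : ∀ K ∈ 𝒯.cells, 2 * supNorm (A.cell t K) (c t) ^ 2 * δ t K ≤ μ)
    (hδ_h : ∀ K ∈ 𝒯.cells, 2 * ε * cinv ^ 2 * δ t K ≤ Metric.diam (A.cell t K) ^ 2)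
    {v : Space d → ℝ} (hv : IsPiecewiseSmooth 𝒯 v)
    (hinv : ∀ K ∈ 𝒯.cells, l2Norm (A.cell t K) (Laplacian.laplacian (A.push t v)) ≤
      cinv * (Metric.diam (A.cell t K))⁻¹ * h1Seminorm (A.cell t K) (A.push t v)) :
    (∫ x in A.domain t, f t x * A.push t v x)
        + (∑ K ∈ 𝒯.cells, δ t K * ∫ x in A.cell t K, f t x * streamline A b t (A.push t v) x)
        - aSUPG A ε b c δ t (A.push t v) (A.push t v)
      ≤ 1 / μ * l2Norm (A.domain t) (f t) ^ 2
        + (∑ K ∈ 𝒯.cells, δ t K * l2Norm (A.cell t K) (f t) ^ 2)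
        - 1 / 4 * tripleNormSq A ε b δ μ t (A.push t v) := by
  have hconv := convection_reaction_ge hT ht hb' hc hcoer hv
  set u := A.push t v with hu_def
  have hu : ∀ K ∈ 𝒯.cells, InteriorContinuous (A.cell t K) u := fun K hK =>
    interiorContinuous_push A hT ht hv hK
  have hg : ∀ K ∈ 𝒯.cells, InteriorContinuous (A.cell t K) (gradient u) := fun K hK =>
    interiorContinuous_gradient_push hT ht hv hK
  have hs : ∀ K ∈ 𝒯.cells, InteriorContinuous (A.cell t K) (streamline A b t u) := fun K hK =>
    interiorContinuous_streamline hT ht hb hv hK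
  have hfc : ∀ K ∈ 𝒯.cells, InteriorContinuous (A.cell t K) (f t) := fun K hK =>
    .of_continuousOn (continuousOn_cell_of_spaceTime hf ht hK)
  have hcv : ∀ K ∈ 𝒯.cells, Convex ℝ (A.cell t K) := fun K hK =>
    (A.motion hT ⟨K, hK⟩).convex_cell ht
  have hcp : ∀ K ∈ 𝒯.cells, IsCompact (A.cell t K) := fun K hK =>
    (A.motion hT ⟨K, hK⟩).isCompact_cell ht
  have hX := A.integral_domain_of_interiorContinuous hT ht fun K hK => (hu K hK).pow 2
  have hG := A.integral_domain_of_interiorContinuous hT ht fun K hK => (hg K hK).norm_sq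
  have hP := A.integral_domain_of_interiorContinuous hT ht fun K hK => (hfc K hK).pow 2
  have hFU := A.integral_domain_of_interiorContinuous hT ht fun K hK => (hfc K hK).mul (hu K hK)
  -- Convection and reaction appear here only through their lower bound μ‖u‖², because the
  -- integration by parts is valid only on the whole domain. Stabilization leaves half of each term
  -- of the triple norm; Young's inequality takes a quarter of the streamline and μ terms.
  have hcell : ∀ K ∈ 𝒯.cells,
      (∫ x in A.cell t K, f t x * u x)
        + δ t K * (∫ x in A.cell t K, f t x * streamline A b t u x)
        - ε * (∫ x in A.cell t K, ‖gradient u x‖ ^ 2) - μ * (∫ x in A.cell t K, u x ^ 2)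
        - δ t K * (∫ x in A.cell t K, (-ε * Laplacian.laplacian u x + streamline A b t u x
            + c t x * u x) * streamline A b t u x)
      ≤ 1 / μ * (∫ x in A.cell t K, f t x ^ 2) + δ t K * (∫ x in A.cell t K, f t x ^ 2)
        - 1 / 4 * (ε * (∫ x in A.cell t K, ‖gradient u x‖ ^ 2)
          + δ t K * (∫ x in A.cell t K, streamline A b t u x ^ 2)
          + μ * ∫ x in A.cell t K, u x ^ 2) := by
    intro K hK
    have h1 := stabilization_ge (ε := ε) (hcv K hK) (hcp K hK)
      (InteriorContinuous.laplacian
        ((A.motion hT ⟨K, hK⟩).contDiffOn_push ht hK (hv.contDiffOn_cell K hK)) (hcv K hK)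
        ((A.motion hT ⟨K, hK⟩).interior_cell_nonempty ht hK))
      (hs K hK) (.of_continuousOn (continuousOn_cell_of_spaceTime hc ht hK)) (hu K hK)
      (fun x hx => abs_le_supNorm (hcp K hK) (continuousOn_cell_of_spaceTime hc ht hK) hx)
    have h2 := integral_mul_le (hcv K hK) (hcp K hK) hμ (hfc K hK) (hu K hK)
    have h3 := integral_mul_le (hcv K hK) (hcp K hK) one_pos (hfc K hK) (hs K hK)
    have h4 := pow_le_pow_left₀ (l2Norm_nonneg _ _) (hinv K hK) 2
    rw [mul_pow, h1Seminorm, l2Norm_sq_real, l2Norm_sq] at h4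
    have h5 : ε ^ 2 * δ t K * (cinv * (Metric.diam (A.cell t K))⁻¹) ^ 2 ≤ ε / 2 := by
      have h6 := mul_le_mul_of_nonneg_right (hδ_h K hK)
        (sq_nonneg (Metric.diam (A.cell t K))⁻¹)
      -- With `0⁻¹ = 0` the product of the diameter and its inverse is at most 1 in all cases, so
      -- positivity of the diameter is not needed.
      have h7 : Metric.diam (A.cell t K) ^ 2 * (Metric.diam (A.cell t K))⁻¹ ^ 2 ≤ 1 := by
        rw [← mul_pow]
        refine pow_le_one₀ (by positivity) mul_inv_le_one
      nlinarith [mul_le_mul_of_nonneg_left (h6.trans h7) hε.le]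
    have hδK := hδ K hK
    have hXn : 0 ≤ ∫ x in A.cell t K, u x ^ 2 := integral_nonneg fun _ => sq_nonneg _
    have hGn : 0 ≤ ∫ x in A.cell t K, ‖gradient u x‖ ^ 2 := integral_nonneg fun _ => sq_nonneg _
    have h8 := mul_le_mul_of_nonneg_left h4 (mul_nonneg (sq_nonneg ε) hδK)
    have h9 := mul_le_mul_of_nonneg_right h5 hGn
    have h10 := mul_le_mul_of_nonneg_right (hδ_c K hK) hXn
    have h11 := mul_le_mul_of_nonneg_left h1 hδK
    have h12 := mul_le_mul_of_nonneg_left h3 hδK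
    have h13 := mul_nonneg hε.le hGn
    rw [one_div]
    linarith
  have hsum := Finset.sum_le_sum hcell
  simp only [Finset.sum_add_distrib, Finset.sum_sub_distrib, ← Finset.mul_sum] at hsum
  rw [← hX, ← hG, ← hP, ← hFU] at hsum
  simp only [aSUPG, tripleNormSq, h1Seminorm, l2Norm_sq_real, l2Norm_sq (F := Space d),
    real_inner_self_eq_norm_sq]
  linarith

end

/-! ### Continuity in time and integrability of the terms of the estimate. -/

section

variable {d N : ℕ} {𝒯 : Triangulation d} {T : ℝ} {F G H : Type*} [NormedAddCommGroup F]
  [NormedAddCommGroup G] [NormedAddCommGroup H]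

/-- Transported to the reference cell `K`, the time-dependent function `g` agrees in the interior
with a function which is continuous on the closed space-time cylinder over `K`. -/
def MotionContinuous (A : ALEMap 𝒯 T) (K : Finset (Space d)) (g : ℝ → Space d → F) : Prop :=
  ∃ h : ℝ × Space d → F, ContinuousOn h (Icc 0 T ×ˢ convexHull ℝ (K : Set (Space d))) ∧
    ∀ t ∈ Icc 0 T, ∀ Y ∈ interior (convexHull ℝ (K : Set (Space d))), g t (A.map t Y) = h (t, Y)

variable {A : ALEMap 𝒯 T} {K : Finset (Space d)}

namespace MotionContinuous

theorem comp {g : ℝ → Space d → F} (hg : MotionContinuous A K g) {Φ : F → G}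
    (hΦ : Continuous Φ) : MotionContinuous A K fun t x => Φ (g t x) := by
  obtain ⟨h, hc, he⟩ := hg
  exact ⟨fun p => Φ (h p), hΦ.comp_continuousOn hc, fun t ht Y hY => congrArg Φ (he t ht Y hY)⟩

theorem comp₂ {g : ℝ → Space d → F} {k : ℝ → Space d → G} (hg : MotionContinuous A K g)
    (hk : MotionContinuous A K k) {Φ : F × G → H} (hΦ : Continuous Φ) :
    MotionContinuous A K fun t x => Φ (g t x, k t x) := by
  obtain ⟨h, hc, he⟩ := hg
  obtain ⟨l, lc, le⟩ := hk
  exact ⟨fun p => Φ (h p, l p), hΦ.comp_continuousOn (hc.prodMk lc),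
    fun t ht Y hY => by simp only [he t ht Y hY, le t ht Y hY]⟩

/-- Pulled back to the fixed reference cell, the integrand is continuous on a compact cylinder up to
a null set, so dominated convergence applies with a constant bound. -/
theorem continuousOn_integral_cell (m : CellMotion A K) {g : ℝ → Space d → ℝ}
    (hg : MotionContinuous A K g) :
    ContinuousOn (fun t => ∫ x in A.cell t K, g t x) (Icc 0 T) := by
  obtain ⟨h, hc, he⟩ := hg
  have hK := Triangulation.isCompact_convexHull K
  have h1 : ContinuousOn (fun t => ∫ Y in convexHull ℝ (K : Set (Space d)), h (t, Y))
      (Icc 0 T) := by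
    obtain ⟨C, hC⟩ := (isCompact_Icc.prod hK).exists_bound_of_continuousOn hc
    refine continuousOn_of_dominated (bound := fun _ => C) (fun t ht => ?_) (fun t ht => ?_) ?_ ?_
    · exact (hc.comp (f := fun Y => (t, Y)) (by fun_prop)
        fun Y hY => ⟨ht, hY⟩).aestronglyMeasurable hK.measurableSet
    · filter_upwards [ae_restrict_mem hK.measurableSet] with Y hY using hC (t, Y) ⟨ht, hY⟩
    · exact integrableOn_const hK.measure_lt_top.ne
    · filter_upwards [ae_restrict_mem hK.measurableSet] with Y hY
      exact hc.comp (f := fun t => (t, Y)) (by fun_prop) fun t ht => ⟨ht, hY⟩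
  refine (m.continuousOn_abs_det.mul h1).congr fun t ht => ?_
  rw [m.integral_cell ht, integral_smul, smul_eq_mul]
  congr 1
  refine integral_congr_ae (InteriorContinuous.ae_eq (convex_convexHull ℝ _) hK fun Y hY => ?_)
  rw [← he t ht Y hY, m.map_eq t ht Y (interior_subset hY)]

theorem of_spaceTime (m : CellMotion A K) (hK : K ∈ 𝒯.cells) {g : ℝ → Space d → F}
    (hg : ContinuousOn (fun p : ℝ × Space d => g p.1 p.2) A.spaceTime) :
    MotionContinuous A K g := by
  refine ⟨fun p => g p.1 (m.lin p.1 p.2 + m.trans p.1), ?_, fun t ht Y hY => by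
    rw [m.map_eq t ht Y (interior_subset hY)]⟩
  refine hg.comp (f := fun p : ℝ × Space d => (p.1, m.lin p.1 p.2 + m.trans p.1)) ?_ ?_
  · refine continuousOn_fst.prodMk (((m.continuousOn_lin.comp continuousOn_fst
      fun p hp => hp.1).clm_apply continuousOn_snd).add
      (m.continuousOn_trans.comp continuousOn_fst fun p hp => hp.1))
  · rintro ⟨t, Y⟩ ⟨ht, hY⟩
    refine ⟨ht, Y, Triangulation.cell_subset_closedRegion hK hY, ?_⟩
    exact m.map_eq t ht Y hY

theorem velocity (m : CellMotion A K) (hT : 0 < T) (hK : K ∈ 𝒯.cells) :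
    MotionContinuous A K A.velocity := by
  refine ⟨fun p => m.lin' p.1 p.2 + m.trans' p.1, ?_, fun t ht Y hY => ?_⟩
  · exact ((m.continuousOn_lin'.comp continuousOn_fst
      fun p hp => hp.1).clm_apply continuousOn_snd).add
      (m.continuousOn_trans'.comp continuousOn_fst fun p hp => hp.1)
  · rw [ALEMap.velocity, A.push_map ht _
      (Triangulation.cell_subset_closedRegion hK (interior_subset hY)),
      m.derivWithin_map hT ht (interior_subset hY)]

/-- By the chain rule the differential is the reference differential composed with the inverse
linear part. Both factors extend continuously to the closed cylinder. -/
theorem gradient_feFunction (m : CellMotion A K) (hK : K ∈ 𝒯.cells) (V : FESpace 𝒯 N)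
    {U : ℝ → Fin N → ℝ} (hU : ContinuousOn U (Icc 0 T)) :
    MotionContinuous A K fun t => gradient (feFunction A V U t) := by
  set S := convexHull ℝ (K : Set (Space d)) with hS
  have hu := uniqueDiffOn_convex (convex_convexHull ℝ (K : Set (Space d)))
    (Triangulation.interior_cell_nonempty hK)
  have hfst : ∀ {E : Type _} [TopologicalSpace E] {φ : ℝ → E}, ContinuousOn φ (Icc 0 T) →
      ContinuousOn (fun p : ℝ × Space d => φ p.1) (Icc 0 T ×ˢ S) := fun hφ =>
    hφ.comp continuousOn_fst fun p hp => hp.1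
  refine ⟨fun p => (InnerProductSpace.toDual ℝ (Space d)).symm
    ((∑ i, U p.1 i • fderivWithin ℝ (V.basis i) S p.2).comp (m.inv p.1)), ?_, fun t ht Y hY => ?_⟩
  · refine (InnerProductSpace.toDual ℝ (Space d)).symm.continuous.comp_continuousOn
      (ContinuousOn.clm_comp (continuousOn_finsetSum _ fun i _ => ?_) (hfst m.continuousOn_inv))
    exact (hfst (continuousOn_pi.1 hU i)).smul
      (((V.contDiffOn_cell i K hK).continuousOn_fderivWithin hu one_le_two).comp continuousOn_snd
        fun p hp => hp.2)
  · have hYS := mem_interior_iff_mem_nhds.1 hY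
    have hv : HasFDerivAt (∑ i, U t i • V.basis i)
        (∑ i, U t i • fderivWithin ℝ (V.basis i) S Y) Y := by
      refine HasFDerivAt.sum fun i _ => HasFDerivAt.const_smul ?_ _
      rw [fderivWithin_of_mem_nhds hYS]
      exact (((V.contDiffOn_cell i K hK).contDiffAt hYS).differentiableAt two_ne_zero).hasFDerivAt
    have hmap := m.map_eq t ht Y (interior_subset hY)
    have hYx : m.inv t (A.map t Y - m.trans t) = Y := by
      rw [hmap, add_sub_cancel_right, m.inv_lin ht]
    have hcomp : HasFDerivAt (fun x => (∑ i, U t i • V.basis i) (m.inv t (x - m.trans t)))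
        ((∑ i, U t i • fderivWithin ℝ (V.basis i) S Y).comp (m.inv t)) (A.map t Y) := by
      have h2 : HasFDerivAt (fun x => m.inv t (x - m.trans t)) (m.inv t) (A.map t Y) :=
        (m.inv t).hasFDerivAt.comp (A.map t Y) ((hasFDerivAt_id _).sub_const _)
      exact HasFDerivAt.comp (A.map t Y) (by rw [hYx]; exact hv) h2
    have hint : A.map t Y ∈ interior (A.cell t K) := by
      rw [m.interior_cell ht]
      exact ⟨Y, hY, by rw [m.homeo_apply, hmap]⟩
    have he : feFunction A V U t =ᶠ[nhds (A.map t Y)]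
        fun x => (∑ i, U t i • V.basis i) (m.inv t (x - m.trans t)) := by
      filter_upwards [mem_interior_iff_mem_nhds.1 hint] with x hx using m.push_eq ht hK _ hx
    simp only [gradient, he.fderiv_eq, hcomp.fderiv]

theorem streamline_feFunction (m : CellMotion A K) (hT : 0 < T) (hK : K ∈ 𝒯.cells)
    (V : FESpace 𝒯 N) {b : ℝ → Space d → Space d}
    (hb : ContinuousOn (fun p : ℝ × Space d => b p.1 p.2) A.spaceTime)
    {U : ℝ → Fin N → ℝ} (hU : ContinuousOn U (Icc 0 T)) :
    MotionContinuous A K fun t => streamline A b t (feFunction A V U t) :=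
  ((of_spaceTime m hK hb).comp₂ (velocity m hT hK) continuous_sub).comp₂
    (gradient_feFunction m hK V hU)
    (Φ := fun p : Space d × Space d => inner ℝ p.1 p.2) continuous_inner

end MotionContinuous

variable {ε μ cinv : ℝ} {b : ℝ → Space d → Space d} {c f : ℝ → Space d → ℝ}
  {δ : ℝ → Finset (Space d) → ℝ} {V : FESpace 𝒯 N} {U : ℝ → Fin N → ℝ}

/-- The weights are only bounded and measurable in time, so integrability comes from bounded times
continuous rather than from continuity of the sum. -/
theorem integrableOn_weighted_sum
    (hδ_nonneg : ∀ t ∈ Icc 0 T, ∀ K ∈ 𝒯.cells, 0 ≤ δ t K)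
    (hδ_meas : ∀ K ∈ 𝒯.cells, AEMeasurable (fun t => δ t K) (volume.restrict (Icc 0 T)))
    (hδ_bdd : ∃ C : ℝ, ∀ t ∈ Icc 0 T, ∀ K ∈ 𝒯.cells, δ t K ≤ C)
    {g : ℝ → Finset (Space d) → ℝ}
    (hg : ∀ K ∈ 𝒯.cells, ContinuousOn (fun t => g t K) (Icc 0 T)) :
    IntegrableOn (fun t => ∑ K ∈ 𝒯.cells, δ t K * g t K) (Icc 0 T) := by
  obtain ⟨C, hC⟩ := hδ_bdd
  refine integrable_finsetSum _ fun K hK => ?_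
  refine IntegrableOn.mul_continuousOn ?_ (hg K hK) isCompact_Icc
  refine Integrable.of_bound (hδ_meas K hK).aestronglyMeasurable C ?_
  filter_upwards [ae_restrict_mem measurableSet_Icc] with t ht
  rw [Real.norm_of_nonneg (hδ_nonneg t ht K hK)]
  exact hC t ht K hK

theorem continuousOn_l2Norm_domain_sq (hT : 0 < T)
    (hf : ContinuousOn (fun p : ℝ × Space d => f p.1 p.2) A.spaceTime) :
    ContinuousOn (fun t => l2Norm (A.domain t) (f t) ^ 2) (Icc 0 T) := by
  have h : ContinuousOn (fun t => ∑ K ∈ 𝒯.cells, ∫ x in A.cell t K, f t x ^ 2) (Icc 0 T) :=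
    continuousOn_finsetSum _ fun K hK => MotionContinuous.continuousOn_integral_cell
      (A.motion hT ⟨K, hK⟩)
      ((MotionContinuous.of_spaceTime (A.motion hT ⟨K, hK⟩) hK hf).comp (continuous_pow 2))
  refine h.congr fun t ht => ?_
  rw [l2Norm_sq_real, A.integral_domain_of_interiorContinuous hT ht fun K hK =>
    (InteriorContinuous.of_continuousOn (continuousOn_cell_of_spaceTime hf ht hK)).pow 2]

theorem integrableOn_tripleNormSq (hT : 0 < T)
    (hb : ContinuousOn (fun p : ℝ × Space d => b p.1 p.2) A.spaceTime)
    (hδ_nonneg : ∀ t ∈ Icc 0 T, ∀ K ∈ 𝒯.cells, 0 ≤ δ t K)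
    (hδ_meas : ∀ K ∈ 𝒯.cells, AEMeasurable (fun t => δ t K) (volume.restrict (Icc 0 T)))
    (hδ_bdd : ∃ C : ℝ, ∀ t ∈ Icc 0 T, ∀ K ∈ 𝒯.cells, δ t K ≤ C)
    (hU : ContinuousOn U (Icc 0 T)) :
    IntegrableOn (fun t => tripleNormSq A ε b δ μ t (feFunction A V U t)) (Icc 0 T) := by
  have h1 : ContinuousOn (fun t => h1Seminorm (A.domain t) (feFunction A V U t) ^ 2)
      (Icc 0 T) := by
    have h : ContinuousOn
        (fun t => ∑ K ∈ 𝒯.cells, ∫ x in A.cell t K, ‖gradient (feFunction A V U t) x‖ ^ 2)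
        (Icc 0 T) :=
      continuousOn_finsetSum _ fun K hK => MotionContinuous.continuousOn_integral_cell
        (A.motion hT ⟨K, hK⟩)
        ((MotionContinuous.gradient_feFunction (A.motion hT ⟨K, hK⟩) hK V hU).comp
          (continuous_norm.pow 2))
    refine h.congr fun t ht => ?_
    rw [h1Seminorm, l2Norm_sq, feFunction, A.integral_domain_of_interiorContinuous hT ht fun K hK =>
      (interiorContinuous_gradient_push hT ht (V.isPiecewiseSmooth (U t)) hK).norm_sq]
    rfl
  have h2 := integrableOn_weighted_sum hδ_nonneg hδ_meas hδ_bdd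
    (g := fun t K => l2Norm (A.cell t K) (streamline A b t (feFunction A V U t)) ^ 2)
    fun K hK => by
      simp only [l2Norm_sq_real]
      exact MotionContinuous.continuousOn_integral_cell (A.motion hT ⟨K, hK⟩)
        ((MotionContinuous.streamline_feFunction (A.motion hT ⟨K, hK⟩) hT hK V hb hU).comp
          (continuous_pow 2))
  exact ((((continuousOn_const.mul h1).integrableOn_compact isCompact_Icc).add h2).add
    ((continuousOn_const.mul
      (continuousOn_l2Norm_feFunction_sq A V hT hU)).integrableOn_compact isCompact_Icc))

end

end ALESUPG

end

/-! ### The energy inequality and its integration in time. -/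

open ALESUPG in
theorem mainTheorem2 {d N : ℕ} (hd : 1 ≤ d) (𝒯 : ALESUPG.Triangulation d)
    {T : ℝ} (hT : 0 < T) (A : ALESUPG.ALEMap 𝒯 T) (V : ALESUPG.FESpace 𝒯 N)
    (ε μ cinv : ℝ) (hε : 0 < ε) (hμ : 0 < μ)
    (b : ℝ → ALESUPG.Space d → ALESUPG.Space d) (c f : ℝ → ALESUPG.Space d → ℝ)
    (δ : ℝ → Finset (ALESUPG.Space d) → ℝ)
    (hb : ContinuousOn (fun p : ℝ × ALESUPG.Space d => b p.1 p.2) A.spaceTime)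
    (hb' : ∀ t ∈ Icc 0 T, ContDiffOn ℝ 1 (b t) (A.closedDomain t))
    (hc : ContinuousOn (fun p : ℝ × ALESUPG.Space d => c p.1 p.2) A.spaceTime)
    (hf : ContinuousOn (fun p : ℝ × ALESUPG.Space d => f p.1 p.2) A.spaceTime)
    (hcoer : ∀ t ∈ Icc 0 T, ∀ x ∈ A.domain t,
      μ ≤ c t x - 1 / 2 * ALESUPG.divergence (b t) x)
    (hδ_nonneg : ∀ t ∈ Icc 0 T, ∀ K ∈ 𝒯.cells, 0 ≤ δ t K)
    (hδ_meas : ∀ K ∈ 𝒯.cells, AEMeasurable (fun t => δ t K) (volume.restrict (Icc 0 T)))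
    (hδ_bdd : ∃ C : ℝ, ∀ t ∈ Icc 0 T, ∀ K ∈ 𝒯.cells, δ t K ≤ C)
    (hδ_c : ∀ t ∈ Icc 0 T, ∀ K ∈ 𝒯.cells,
      2 * ALESUPG.supNorm (A.cell t K) (c t) ^ 2 * δ t K ≤ μ)
    (hcinv : ALESUPG.IsInverseConstant A V cinv)
    (hδ_h : ∀ t ∈ Icc 0 T, ∀ K ∈ 𝒯.cells,
      2 * ε * cinv ^ 2 * δ t K ≤ Metric.diam (A.cell t K) ^ 2)
    (U : ℝ → Fin N → ℝ) (hU : ALESUPG.IsSemidiscreteSolution A ε b c f δ V U) :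
    IntervalIntegrable
        (fun t => ALESUPG.tripleNormSq A ε b δ μ t (ALESUPG.feFunction A V U t)) volume 0 T ∧
      IntervalIntegrable (fun t => ALESUPG.l2Norm (A.domain t) (f t) ^ 2) volume 0 T ∧
      IntervalIntegrable
        (fun t => ∑ K ∈ 𝒯.cells, δ t K * ALESUPG.l2Norm (A.cell t K) (f t) ^ 2) volume 0 T ∧
      ALESUPG.l2Norm (A.domain T) (ALESUPG.feFunction A V U T) ^ 2
          + 1 / 2 * ∫ t in 0..T,
              ALESUPG.tripleNormSq A ε b δ μ t (ALESUPG.feFunction A V U t)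
        ≤ ALESUPG.l2Norm (A.domain 0) (ALESUPG.feFunction A V U 0) ^ 2
          + 2 / μ * (∫ t in 0..T, ALESUPG.l2Norm (A.domain t) (f t) ^ 2)
          + 2 * ∫ t in 0..T,
              ∑ K ∈ 𝒯.cells, δ t K * ALESUPG.l2Norm (A.cell t K) (f t) ^ 2 := by

  have hE := continuousOn_l2Norm_feFunction_sq A V hT hU.continuousOn
  have htri := integrableOn_tripleNormSq (ε := ε) (μ := μ) (V := V) hT hb hδ_nonneg hδ_meas hδ_bdd
    hU.continuousOn
  have hf1 := (continuousOn_l2Norm_domain_sq hT hf).integrableOn_compact (μ := volume) isCompact_Icc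
  have hf2 := integrableOn_weighted_sum hδ_nonneg hδ_meas hδ_bdd
    (g := fun t K => l2Norm (A.cell t K) (f t) ^ 2) fun K hK => by
      simp only [l2Norm_sq_real]
      exact MotionContinuous.continuousOn_integral_cell (A.motion hT ⟨K, hK⟩)
        ((MotionContinuous.of_spaceTime (A.motion hT ⟨K, hK⟩) hK hf).comp (continuous_pow 2))
  have hderiv : ∀ t ∈ Ioc 0 T, ∃ E', HasDerivWithinAt
      (fun s => l2Norm (A.domain s) (feFunction A V U s) ^ 2) E' (Icc 0 T) t ∧
      E' ≤ 2 / μ * l2Norm (A.domain t) (f t) ^ 2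
        + 2 * (∑ K ∈ 𝒯.cells, δ t K * l2Norm (A.cell t K) (f t) ^ 2)
        - 1 / 2 * tripleNormSq A ε b δ μ t (feFunction A V U t) := by
    intro t ht
    have ht' : t ∈ Icc 0 T := Ioc_subset_Icc_self ht
    -- The test function is the solution with its coefficients frozen at `t`, as admissible test
    -- functions must not depend on time on the reference domain.
    obtain ⟨D, hD, heq⟩ := hU.equation t ht _ (V.sum_mem_space (U t))
    refine ⟨_, hasDerivWithinAt_l2Norm_feFunction_sq A V hT ht' (hU.differentiable t ht) hD, ?_⟩
    have h1 := integral_divergence_smul_velocity A hT ht' (V.isPiecewiseSmooth (U t))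
    have h2 := load_sub_aSUPG_le (cinv := cinv) hT ht' hε hμ hb (hb' t ht') hc hf (hcoer t ht')
      (hδ_nonneg t ht') (hδ_c t ht') (hδ_h t ht') (V.isPiecewiseSmooth (U t))
      fun K hK => hcinv.2 t ht' K hK _ (V.sum_mem_space (U t))
    simp only [feFunction] at heq ⊢
    -- After this, twice the velocity term in `heq` equals the (div w) u² integral in Reynolds'
    -- formula, and the two cancel in the final `linarith`.
    rw [h1] at heq
    have h3 : 2 / μ = 2 * (1 / μ) := by ring
    rw [h3]
    linarith
  choose! E' hE' hle using hderiv
  -- This form needs only continuity on [0, T] and an integrable upper bound for the derivative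
  -- inside. The derivative may fail to exist at 0, and its own integrability is not required.
  have hmain := intervalIntegral.sub_le_integral_of_hasDeriv_right_of_le hT.le hE
    (fun t ht => ((hE' t ⟨ht.1, ht.2.le⟩).hasDerivAt (Icc_mem_nhds ht.1 ht.2)).hasDerivWithinAt)
    (((hf1.const_mul (2 / μ)).add (hf2.const_mul 2)).sub (htri.const_mul (1 / 2)))
    (fun t ht => hle t ⟨ht.1, ht.2.le⟩)
  have hI : ∀ {g : ℝ → ℝ}, IntegrableOn g (Icc 0 T) → IntervalIntegrable g volume 0 T := fun hg =>
    (intervalIntegrable_iff_integrableOn_Icc_of_le hT.le).2 hg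
  refine ⟨hI htri, hI hf1, hI hf2, ?_⟩
  simp only [Pi.sub_apply, Pi.add_apply] at hmain
  rw [intervalIntegral.integral_sub (((hI hf1).const_mul _).add ((hI hf2).const_mul _))
      ((hI htri).const_mul _),
    intervalIntegral.integral_add ((hI hf1).const_mul _) ((hI hf2).const_mul _),
    intervalIntegral.integral_const_mul, intervalIntegral.integral_const_mul,
    intervalIntegral.integral_const_mul] at hmain
  linarith
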